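/- **Theorem 4.1 (Keller–Osserman theorem for $k$-Hessian type equations).** Let $1\le k\le n$ be integers, let $f:\mathbb R\to(0,\infty)$ be continuous and non-decreasing, and let $p>1$, $\beta<p-1$, $\alpha\ge \frac1k-1$ be real numbers. For a vector $\lambda\in\mathbb R^n$ put $S_i(\lambda)=\sum_{j_1<\dots<j_i}\lambda_{j_1}\cdots\lambda_{j_i}$ and $\Gamma_k=\{\lambda\in\mathbb R^n: S_i(\lambda)>0,\ i=1,\dots,k\}$. For a real $n\times n$ matrix $A$ with real eigenvalues $\lambda(A)$ (listed with multiplicity) put $S_k[A]=S_k(\lambda(A))$. Consider the equation $$S_k^{1/k}\big[D(|Du|^{p-2}Du)\big]=|x|^\alpha|Du|^\beta f(u)\quad\text{in }\mathbb R^n. \tag{1}$$ An *entire nontrivial admissible subsolution* of (1) is a non-constant function $u\in C^1(\mathbb R^n)\cap C^2(\mathbb R^n\setminus\{0\})$ such that at every $x\ne0$ the field $|Du|^{p-2}Du$ (understood as $0$ where $Du=0$) is differentiable, the eigenvalues of $D(|Du|^{p-2}Du)(x)$ are real and form a vector in $\Gamma_k$, $Du(x)\neq 0$ if $\beta<0$,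 and $S_k^{1/k}[D(|Du|^{p-2}Du)]\ge|x|^\alpha|Du|^\beta f(u)$ at $x$ (with $0^0=1$). Consider also the condition $$\int^{+\infty}\Big(\int_0^t f^k(s)\,ds\Big)^{-\frac1{k(p-\beta-1)+1}}dt=+\infty, \tag{2}$$ where the lower limit of the outer integral is any positive number. (i) If $p\le\alpha+\beta+2$, then (1) has an entire nontrivial admissible subsolution $u\in C^2(\mathbb R^n)$ if and only if (2) holds. Moreover, if (2) holds and $(p-1)\alpha+\beta\ge0$, then such a $u$ can be chosen with $|Du|^{p-2}Du\in C^1(\mathbb R^n)$. (ii) If $p>\alpha+\beta+2$ and $(p-1)\alpha+\beta\ge0$, then for every $\delta\in\big(1,\frac{p-\beta-1}{p-\alpha-\beta-2}\big)$ the equation (1) has an entire nontrivial admissible subsolution $u\in W^{2,\delta}_{\mathrm{loc}}(\mathbb R^n)$ if and only if (2) holds. Moreover, if (2) holds, then one $u$ can be chosen which serves for all these $\delta$ and satisfies $|Du|^{p-2}Du\in C^1(\mathbb R^n)$. -/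

import Mathlib

open scoped ContDiff Gradient

noncomputable section

/-- The elementary symmetric polynomial `S_k(l) = ∑_{i_1 < ⋯ < i_k} l_{i_1} ⋯ l_{i_k}`. -/
def symPoly {n : ℕ} (k : ℕ) (l : Fin n → ℝ) : ℝ :=
  ∑ s ∈ Finset.powersetCard k (Finset.univ : Finset (Fin n)), ∏ i ∈ s, l i

/-- The Gårding cone `Γ_k = {l ∈ ℝⁿ | S_i(l) > 0, i = 1, …, k}`. -/
def gardingCone (n k : ℕ) : Set (Fin n → ℝ) :=
  {l | ∀ i, 1 ≤ i → i ≤ k → 0 < symPoly i l}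

/-- `l = (l_1, …, l_n)` lists the eigenvalues of the real matrix `A` (all of them real),
with algebraic multiplicity. It determines `l` up to the order. -/
def IsEigenvalueVector {n : ℕ} (A : Matrix (Fin n) (Fin n) ℝ) (l : Fin n → ℝ) : Prop :=
  A.charpoly = ∏ i, (Polynomial.X - Polynomial.C (l i))

/-- The vector field `|Du|^{p-2} Du`. -/
def pGradient {n : ℕ} (p : ℝ) (u : EuclideanSpace ℝ (Fin n) → ℝ) :
    EuclideanSpace ℝ (Fin n) → EuclideanSpace ℝ (Fin n) :=
  fun x => ‖∇ u x‖ ^ (p - 2) • ∇ u x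

/-- The matrix `D(|Du|^{p-2} Du)(x)`, whose `(i, j)` entry is `D_i (|Du|^{p-2} D_j u)(x)`. -/
def pHessian {n : ℕ} (p : ℝ) (u : EuclideanSpace ℝ (Fin n) → ℝ)
    (x : EuclideanSpace ℝ (Fin n)) : Matrix (Fin n) (Fin n) ℝ :=
  Matrix.of fun i j => (fderiv ℝ (pGradient p u) x (EuclideanSpace.single i 1)) j

/-- At the point `x` the matrix `D(|Du|^{p-2} Du)` exists, its eigenvalues lie in `Γ_k`, and
`S_k^{1/k}[D(|Du|^{p-2} Du)] ≥ |x|^α |Du|^β f(u)`. (If `β < 0` and `Du(x) = 0`, the right-hand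
side is infinite for `x ≠ 0`, so the inequality fails there; the definition is used for `x ≠ 0`.) -/
def IsAdmissibleSubsolutionAt {n : ℕ} (k : ℕ) (p α β : ℝ) (f : ℝ → ℝ)
    (u : EuclideanSpace ℝ (Fin n) → ℝ) (x : EuclideanSpace ℝ (Fin n)) : Prop :=
  DifferentiableAt ℝ (pGradient p u) x ∧
  (β < 0 → ∇ u x ≠ 0) ∧
  ∃ l : Fin n → ℝ, IsEigenvalueVector (pHessian p u x) l ∧ l ∈ gardingCone n k ∧
    ‖x‖ ^ α * ‖∇ u x‖ ^ β * f (u x) ≤ symPoly k l ^ (1 / (k : ℝ))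

/-- Entire nontrivial admissible subsolution: a nonconstant function in `C¹(ℝⁿ) ∩ C²(ℝⁿ \ {0})`
which is admissible and satisfies the differential inequality at every `x ≠ 0`. At the origin the
equation degenerates or is singular, and only the regularity of `u` is prescribed. -/
structure IsEntireAdmissibleSubsolution {n : ℕ} (k : ℕ) (p α β : ℝ) (f : ℝ → ℝ)
    (u : EuclideanSpace ℝ (Fin n) → ℝ) : Prop where
  contDiff_one : ContDiff ℝ 1 u
  contDiffOn_two : ContDiffOn ℝ 2 u {0}ᶜ
  nontrivial : ∃ x y, u x ≠ u y
  subsolution : ∀ x, x ≠ 0 → IsAdmissibleSubsolutionAt k p α β f u x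

/-- `g` is in `L^δ(K)` for every compact `K ⊂ ℝⁿ`. -/
def MemLpLoc {n : ℕ} (δ : ℝ) (g : EuclideanSpace ℝ (Fin n) → ℝ) : Prop :=
  ∀ K : Set (EuclideanSpace ℝ (Fin n)), IsCompact K →
    MeasureTheory.MemLp g (ENNReal.ofReal δ) (MeasureTheory.volume.restrict K)

/-- `g` is the weak partial derivative `D_i w` on `ℝⁿ` (for locally integrable `w`, `g`). -/
def IsWeakPartial {n : ℕ} (i : Fin n) (w g : EuclideanSpace ℝ (Fin n) → ℝ) : Prop :=
  ∀ φ : EuclideanSpace ℝ (Fin n) → ℝ, ContDiff ℝ ∞ φ → HasCompactSupport φ →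
    ∫ x, w x * fderiv ℝ φ x (EuclideanSpace.single i 1) = - ∫ x, g x * φ x

/-- The local Sobolev space `W^{2,δ}_loc(ℝⁿ)`, `δ ≥ 1`. -/
def MemSobolevTwoLoc {n : ℕ} (δ : ℝ) (u : EuclideanSpace ℝ (Fin n) → ℝ) : Prop :=
  MemLpLoc δ u ∧
  ∃ (g : Fin n → EuclideanSpace ℝ (Fin n) → ℝ)
    (h : Fin n → Fin n → EuclideanSpace ℝ (Fin n) → ℝ),
    (∀ i, MemLpLoc δ (g i) ∧ IsWeakPartial i u (g i)) ∧
    (∀ i j, MemLpLoc δ (h i j) ∧ IsWeakPartial j (g i) (h i j))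

/-- The Keller–Osserman condition
`∫^∞ (∫_0^t f(s)^k ds)^{-1/(k(p-β-1)+1)} dt = ∞`, the lower limit being any positive number. -/
def KellerOsserman (k : ℕ) (p β : ℝ) (f : ℝ → ℝ) : Prop :=
  ∀ a : ℝ, 0 < a →
    ∫⁻ t in Set.Ioi a, ENNReal.ofReal
      ((∫ s in (0 : ℝ)..t, f s ^ k) ^ (-(1 / ((k : ℝ) * (p - β - 1) + 1)))) = ⊤

end

open scoped Topology RealInnerProductSpace
open Filter MeasureTheory

/-! Put `g = f ^ k` and `N = k(p - β - 1) + 1 > 1`.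

Necessity is a comparison argument that needs no regularity beyond admissibility. If the integral in
the Keller–Osserman condition converges, then `T(s) = ∫_m^s (1 + ∫_m^t g)^{-1/N} dt` is bounded
above. Admissible functions have no local maximum off the origin, so `u` exceeds somewhere on `|x| =
2` its bound `m` on `|x| = 1` (`exists_sphere_one_lt_sphere_two`). For small `δ > 0` the function
`T(u) - δ|x|` therefore has an interior maximum in an annulus `1 ≤ |x| ≤ R`. There `Du` is radial of
length `ψ = δ / T'(u)` and `D²u` is bounded by the Hessian of a radial barrier
(`gradient_and_hessian_of_isLocalMax_sub_norm`). The matrix `D(|Du|^{p-2}Du)` is a product of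
symmetric matrices and is similar to a symmetric one, so its eigenvalues inherit the bound: at most
one exceeds the tangential value (`exists_symPoly_eq_of_hessian_le`). In `Γ_k` this bounds `S_k`
from above (`symPoly_le_of_mem_gardingCone`). By `radial_barrier_estimate` the bound is a small
multiple, as `δ → 0`, of the k-th power of the right-hand side, which contradicts the differential
inequality.

Sufficiency is by a radial function `u = v(|x|)`. With `w = v'` the eigenvalues are `(w^{p-1})'`
once and `w^{p-1}/r` otherwise, and it is enough that `r^σ g(v) ≤ (p-1) w^{N-2} w'` with `σ = kα + k
- 1 ≥ 0`. The autonomous equation `V'^N = ∫_0^V g` has a global solution because the integral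
diverges (`exists_global_solution`); `v(r) = V(C r^κ)` absorbs the weight (`exists_radial_profile`).
Near the origin `w` behaves like `r^e` with `e = (α+1)/(p-β-1)`, and each regularity claim is a
condition on this exponent (`IsPowerLike`, `contDiff_one_radialField`,
`memSobolevTwoLoc_of_radialField`). -/

/-! ### Elementary symmetric polynomials and the Gårding cone. -/

theorem symPoly_eq_esymm {n : ℕ} (k : ℕ) (l : Fin n → ℝ) :
    symPoly k l = ((Finset.univ : Finset (Fin n)).val.map l).esymm k :=
  (Finset.esymm_map_val l Finset.univ k).symm

/-- Both vectors list the same multiset of roots. Hence `S_k` depends only on the characteristic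
polynomial, and any convenient eigenvalue vector may be used. -/
theorem symPoly_eq_of_prod_X_sub_C_eq {n : ℕ} {l l' : Fin n → ℝ}
    (h : ∏ i, (Polynomial.X - Polynomial.C (l i)) = ∏ i, (Polynomial.X - Polynomial.C (l' i)))
    (k : ℕ) : symPoly k l = symPoly k l' := by
  have key : ∀ m : Fin n → ℝ, (∏ i, (Polynomial.X - Polynomial.C (m i))).roots =
      (Finset.univ : Finset (Fin n)).val.map m := by
    intro m
    rw [Polynomial.roots_prod]
    · simp
    · simp [Finset.prod_ne_zero_iff, Polynomial.X_sub_C_ne_zero]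
  rw [symPoly_eq_esymm, symPoly_eq_esymm, ← key, ← key, h]

theorem symPoly_one {n : ℕ} (l : Fin n → ℝ) : symPoly 1 l = ∑ i, l i := by
  simp [symPoly, Finset.powersetCard_one]

theorem two_mul_symPoly_two {n : ℕ} (l : Fin n → ℝ) :
    (∑ i, l i) ^ 2 = ∑ i, l i ^ 2 + 2 * symPoly 2 l := by
  have h := MvPolynomial.mul_esymm_eq_sum (Fin n) ℝ 2
  have h2 := congrArg (MvPolynomial.eval l) h
  have e2 : MvPolynomial.eval l (MvPolynomial.esymm (Fin n) ℝ 2) = symPoly 2 l := by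
    simp [MvPolynomial.esymm, symPoly]
  have ea : (Finset.HasAntidiagonal.antidiagonal 2).filter (fun a : ℕ × ℕ => a.1 < 2) = {(0, 2), (1, 1)} := by
    decide
  have e1 : MvPolynomial.eval l (MvPolynomial.esymm (Fin n) ℝ 1) = ∑ i, l i := by
    simp [MvPolynomial.esymm, Finset.powersetCard_one]
  rw [ea] at h2
  simp only [map_mul, map_pow, map_neg, map_one, map_sum, MvPolynomial.psum, e2, e1,
    Finset.sum_insert (show (0, 2) ∉ ({(1, 1)} : Finset (ℕ × ℕ)) by decide),
    Finset.sum_singleton, map_add, MvPolynomial.esymm_zero, MvPolynomial.eval_X, pow_one,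
    map_natCast] at h2
  push_cast at h2
  linarith

/-- In `Γ_k`, if at most one entry exceeds `b` and all are at most `A`, then
`S_k` is controlled by `A b^{k-1}`. -/
theorem symPoly_le_of_mem_gardingCone {n k : ℕ} (hk : 1 ≤ k) {l : Fin n → ℝ}
    (hl : l ∈ gardingCone n k) {A b : ℝ} (hb : 0 < b) (hbA : b ≤ A)
    (hA : ∀ i, l i ≤ A) (hpair : ∀ i j, i ≠ j → l i ≤ b ∨ l j ≤ b) :
    symPoly k l ≤ (2 : ℝ) ^ n * ((n : ℝ) ^ k * (A * b ^ (k - 1))) := by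
  have hS1 : 0 < ∑ i, l i := by rw [← symPoly_one]; exact hl 1 le_rfl hk
  have hn : (Finset.univ : Finset (Fin n)).Nonempty := by
    by_contra h
    rw [Finset.not_nonempty_iff_eq_empty] at h
    simp [h] at hS1
  have hn1 : (1 : ℝ) ≤ n := by
    have : 0 < n := by simpa using hn.card_pos
    exact_mod_cast this
  obtain ⟨i₀, -, hi₀⟩ := Finset.exists_max_image Finset.univ l hn
  have hother : ∀ j, j ≠ i₀ → l j ≤ b := by
    intro j hj
    rcases hpair j i₀ hj with h | h
    · exact h
    · exact (hi₀ j (Finset.mem_univ j)).trans h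
  have hApos : 0 < A := hb.trans_le hbA
  have hcard : ((Finset.powersetCard k (Finset.univ : Finset (Fin n))).card : ℝ) ≤ 2 ^ n := by
    rw [Finset.card_powersetCard, Finset.card_univ, Fintype.card_fin]
    exact_mod_cast Nat.choose_le_two_pow n k
  have hbound : ∀ s ∈ Finset.powersetCard k (Finset.univ : Finset (Fin n)),
      ∏ i ∈ s, l i ≤ (n : ℝ) ^ k * (A * b ^ (k - 1)) := by
    intro s hs
    have hsc : s.card = k := (Finset.mem_powersetCard.1 hs).2
    rcases Nat.eq_or_lt_of_le hk with hk1 | hk2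
    · subst hk1
      obtain ⟨i, rfl⟩ := Finset.card_eq_one.1 hsc
      simp only [Finset.prod_singleton, pow_one, Nat.sub_self, pow_zero, mul_one]
      have := hA i
      nlinarith
    · have hS2 : 0 < symPoly 2 l := hl 2 (by norm_num) hk2
      -- Since `S_2 > 0`, `S_1² = ∑ l_j² + 2 S_2 > l_i²`, so the entries other than `l_i` have
      -- positive sum. Taken at the largest entry, this bounds every other entry below by `-n b`,
      -- because those entries are at most `b`.
      have hrest : ∀ i, l i < ∑ j, l j := by
        intro i
        have h1 := two_mul_symPoly_two l
        have h2 : l i ^ 2 ≤ ∑ j, l j ^ 2 :=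
          Finset.single_le_sum (f := fun j => l j ^ 2) (fun j _ => sq_nonneg _) (Finset.mem_univ i)
        exact lt_of_pow_lt_pow_left₀ 2 hS1.le (by linarith)
      have hmaxpos : 0 ≤ l i₀ := by
        by_contra hneg
        have : ∑ i, l i ≤ 0 :=
          Finset.sum_nonpos fun i hi => (hi₀ i hi).trans (not_le.1 hneg).le
        linarith
      have habs : ∀ j, j ≠ i₀ → |l j| ≤ n * b := by
        intro j hj
        rw [abs_le]
        refine ⟨?_, (hother j hj).trans (by nlinarith)⟩
        have h1 := hrest i₀
        have h2 : ∑ i, l i = l i₀ + (l j + ∑ i ∈ (Finset.univ.erase i₀).erase j, l i) := by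
          rw [Finset.add_sum_erase _ _ (by simp [hj]), Finset.add_sum_erase _ _ (by simp)]
        have h3 : ∑ i ∈ (Finset.univ.erase i₀).erase j, l i ≤
            ((Finset.univ.erase i₀).erase j).card • b := by
          refine Finset.sum_le_card_nsmul _ _ _ fun i hi => hother i ?_
          simp only [Finset.mem_erase] at hi
          exact hi.2.1
        have h4 : (((Finset.univ.erase i₀).erase j).card : ℝ) ≤ n := by
          have : ((Finset.univ.erase i₀).erase j).card ≤ n := by
            simpa using Finset.card_le_univ ((Finset.univ.erase i₀).erase j)
          exact_mod_cast this
        rw [nsmul_eq_mul] at h3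
        nlinarith
      have hmax : |l i₀| ≤ n * A := by
        rw [abs_of_nonneg hmaxpos]
        have := hA i₀
        nlinarith
      calc ∏ i ∈ s, l i ≤ ∏ i ∈ s, |l i| := by
            rw [← Finset.abs_prod]; exact le_abs_self _
        _ ≤ (n : ℝ) ^ k * (A * b ^ (k - 1)) := by
          by_cases his : i₀ ∈ s
          · rw [← Finset.mul_prod_erase _ _ his]
            have h5 : ∏ i ∈ s.erase i₀, |l i| ≤ (n * b) ^ (k - 1) := by
              calc _ ≤ ∏ i ∈ s.erase i₀, (n * b : ℝ) :=
                    Finset.prod_le_prod (fun _ _ => abs_nonneg _)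
                      fun i hi => habs i (Finset.ne_of_mem_erase hi)
                _ = _ := by rw [Finset.prod_const, Finset.card_erase_of_mem his, hsc]
            calc |l i₀| * ∏ i ∈ s.erase i₀, |l i| ≤ (n * A) * (n * b) ^ (k - 1) := by
                  gcongr
              _ = (n : ℝ) ^ (k - 1 + 1) * (A * b ^ (k - 1)) := by ring
              _ = _ := by rw [Nat.sub_add_cancel hk]
          · calc ∏ i ∈ s, |l i| ≤ ∏ i ∈ s, (n * b : ℝ) :=
                  Finset.prod_le_prod (fun _ _ => abs_nonneg _)
                    fun i hi => habs i (fun h => his (h ▸ hi))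
              _ = (n : ℝ) ^ k * b ^ (k - 1 + 1) := by
                  rw [Finset.prod_const, hsc, Nat.sub_add_cancel hk, mul_pow]
              _ ≤ (n : ℝ) ^ k * (A * b ^ (k - 1)) := by
                  rw [pow_succ, mul_comm (b ^ (k - 1))]
                  gcongr
  calc symPoly k l ≤
        (Finset.powersetCard k (Finset.univ : Finset (Fin n))).card •
          ((n : ℝ) ^ k * (A * b ^ (k - 1))) := Finset.sum_le_card_nsmul _ _ _ hbound
    _ ≤ _ := by
      rw [nsmul_eq_mul]
      gcongr

/-! ### Eigenvalues of a product of symmetric matrices. -/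

open Matrix in
/-- Eigenvalue bounds for a product of symmetric matrices whose quadratic form is bounded by
that of a matrix with eigenvalues `A` (in the direction `ν`) and `B` (on its complement). -/
theorem exists_symPoly_eq_of_quadratic_le {n : ℕ} (H : Matrix (Fin n) (Fin n) ℝ)
    (hH : H.IsSymm) (ν : Fin n → ℝ) (hν : ν ⬝ᵥ ν = 1) (c p A B : ℝ) (hc : 0 < c) (hp : 1 < p)
    (hquad : ∀ h : Fin n → ℝ, h ⬝ᵥ (H *ᵥ h) ≤ A * (ν ⬝ᵥ h) ^ 2 + B * (h ⬝ᵥ h - (ν ⬝ᵥ h) ^ 2))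
    {l : Fin n → ℝ}
    (hl : IsEigenvalueVector (c • (H * (1 + (p - 2) • vecMulVec ν ν))) l) :
    ∃ l' : Fin n → ℝ, (∀ j, symPoly j l' = symPoly j l) ∧
      (∀ i, l' i ≤ max (c * (p - 1) * A) (c * B)) ∧
      ∀ i j, i ≠ j → l' i ≤ c * B ∨ l' j ≤ c * B := by
  -- `R = 1 + t ν⊗ν` is the symmetric square root of `1 + (p-2) ν⊗ν`, so `R (cH) R` is symmetric and
  -- has the characteristic polynomial of `cH R²`.
  set t : ℝ := √(p - 1) - 1 with ht
  have ht2 : (1 + t) ^ 2 = p - 1 := by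
    rw [ht, add_sub_cancel, Real.sq_sqrt (by linarith)]
  set R : Matrix (Fin n) (Fin n) ℝ := 1 + t • vecMulVec ν ν with hR
  have hRR : R * R = 1 + (p - 2) • vecMulVec ν ν := by
    rw [hR, add_mul, mul_add, mul_add, one_mul, mul_one, one_mul, smul_mul_smul_comm,
      vecMulVec_mul_vecMulVec, hν]
    have : p - 2 = t + (t + t * t) := by nlinarith
    rw [this, add_smul, add_smul]
    simp [add_assoc]
  have hRT : Rᵀ = R := by
    rw [hR, transpose_add, transpose_one, transpose_smul, transpose_vecMulVec]
  set M : Matrix (Fin n) (Fin n) ℝ := R * (c • H) * R with hM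
  have hMT : Mᵀ = M := by
    rw [hM, transpose_mul, transpose_mul, transpose_smul, hH.eq, hRT, mul_assoc]
  have hMH : M.IsHermitian := by
    rw [Matrix.IsHermitian, conjTranspose_eq_transpose_of_trivial, hMT]
  have hchar : M.charpoly = (c • (H * (1 + (p - 2) • vecMulVec ν ν))).charpoly := by
    rw [hM, mul_assoc, charpoly_mul_comm, ← hRR, ← smul_mul, ← mul_assoc]
  have hRv : ∀ w, R *ᵥ w = w + (t * (ν ⬝ᵥ w)) • ν := by
    intro w
    rw [hR, add_mulVec, one_mulVec, smul_mulVec, vecMulVec_mulVec]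
    ext i; simp; ring
  have hMq : ∀ w, w ⬝ᵥ (M *ᵥ w) ≤
      c * (p - 1) * A * (ν ⬝ᵥ w) ^ 2 + c * B * (w ⬝ᵥ w - (ν ⬝ᵥ w) ^ 2) := by
    intro w
    have h1 : w ⬝ᵥ (M *ᵥ w) = c * ((R *ᵥ w) ⬝ᵥ (H *ᵥ (R *ᵥ w))) := by
      rw [hM, ← mulVec_mulVec, ← mulVec_mulVec, dotProduct_mulVec, ← mulVec_transpose, hRT,
        smul_mulVec, dotProduct_smul, smul_eq_mul]
    have h2 := hquad (R *ᵥ w)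
    have h3 : ν ⬝ᵥ (R *ᵥ w) = (1 + t) * (ν ⬝ᵥ w) := by
      rw [hRv, dotProduct_add, dotProduct_smul, hν]; simp; ring
    have h4 : (R *ᵥ w) ⬝ᵥ (R *ᵥ w) - (ν ⬝ᵥ (R *ᵥ w)) ^ 2 = w ⬝ᵥ w - (ν ⬝ᵥ w) ^ 2 := by
      rw [h3, hRv, dotProduct_add, add_dotProduct, add_dotProduct, smul_dotProduct,
        dotProduct_smul, smul_dotProduct, dotProduct_smul, hν, dotProduct_comm w ν]
      simp only [smul_eq_mul]; ring
    rw [h4, h3, mul_pow, ht2] at h2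
    rw [h1]
    calc c * ((R *ᵥ w) ⬝ᵥ (H *ᵥ (R *ᵥ w))) ≤
        c * (A * ((p - 1) * (ν ⬝ᵥ w) ^ 2) + B * (w ⬝ᵥ w - (ν ⬝ᵥ w) ^ 2)) := by gcongr
      _ = _ := by ring
  set e : Fin n → Fin n → ℝ := fun i => ⇑(hMH.eigenvectorBasis i) with he
  have hee : ∀ i j, e i ⬝ᵥ e j = if i = j then 1 else 0 := by
    intro i j
    have := orthonormal_iff_ite.1 hMH.eigenvectorBasis.orthonormal j i
    rw [EuclideanSpace.inner_eq_star_dotProduct] at this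
    simpa [he, eq_comm] using this
  have hMe : ∀ i, M *ᵥ e i = hMH.eigenvalues i • e i := fun i => hMH.mulVec_eigenvectorBasis i
  refine ⟨hMH.eigenvalues, ?_, ?_, ?_⟩
  · refine symPoly_eq_of_prod_X_sub_C_eq ?_
    have h1 := hMH.charpoly_eq
    rw [hchar, hl] at h1
    simpa using h1.symm
  · intro i
    have h1 := hMq (e i)
    rw [hMe, dotProduct_smul, hee] at h1
    simp only [if_true, smul_eq_mul, mul_one] at h1
    have h2 : (ν ⬝ᵥ e i) ^ 2 ≤ 1 := by
      have h3 : 0 ≤ (ν - (ν ⬝ᵥ e i) • e i) ⬝ᵥ (ν - (ν ⬝ᵥ e i) • e i) := by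
        simpa using dotProduct_star_self_nonneg (ν - (ν ⬝ᵥ e i) • e i)
      have h4 := hee i i
      simp only [if_true] at h4
      rw [dotProduct_sub, sub_dotProduct, sub_dotProduct, smul_dotProduct,
        dotProduct_smul, smul_dotProduct, dotProduct_smul, hν, h4, dotProduct_comm (e i) ν] at h3
      simp only [smul_eq_mul] at h3
      nlinarith
    have h5 := le_max_left (c * (p - 1) * A) (c * B)
    have h6 := le_max_right (c * (p - 1) * A) (c * B)
    have h7 := sq_nonneg (ν ⬝ᵥ e i)
    nlinarith
  · intro i j hij
    by_contra! hcon
    set x := ν ⬝ᵥ e i with hx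
    set y := ν ⬝ᵥ e j with hy
    have hii := hee i i
    have hjj := hee j j
    have hij' := hee i j
    have hji := hee j i
    simp only [if_true, hij, hij.symm, if_false] at hii hjj hij' hji
    -- The span of `e i` and `e j` meets the orthogonal complement of `ν`. There the form is at most
    -- `c * B` times the squared length, so the two eigenvalues cannot both exceed `c * B`.
    by_cases hxy : x = 0
    · have h1 := hMq (e i)
      rw [hMe, dotProduct_smul, hii, ← hx, hxy] at h1
      simp only [smul_eq_mul, mul_one] at h1
      nlinarith
    · have h1 := hMq (y • e i - x • e j)
      have h2 : ν ⬝ᵥ (y • e i - x • e j) = 0 := by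
        rw [dotProduct_sub, dotProduct_smul, dotProduct_smul, ← hx, ← hy]
        simp only [smul_eq_mul]; ring
      rw [h2, mulVec_sub, mulVec_smul, mulVec_smul, hMe, hMe] at h1
      simp only [dotProduct_sub, sub_dotProduct, smul_dotProduct, dotProduct_smul, hii, hjj, hij',
        hji, smul_eq_mul] at h1
      have h8 : 0 < x ^ 2 := by positivity
      have h9 := sq_nonneg y
      nlinarith [mul_pos h8 (sub_pos.2 hcon.2), mul_nonneg h9 (sub_pos.2 hcon.1).le]

/-! ### Maximum tests along lines and the matrix `D(|Du|^{p-2}Du)`. -/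

theorem not_isLocalMax_of_eventually_deriv_pos {g g' : ℝ → ℝ} (hmax : IsLocalMax g 0)
    (hg : ∀ᶠ t in 𝓝 (0 : ℝ), HasDerivAt g (g' t) t) (hpos : ∀ᶠ t in 𝓝[>] (0 : ℝ), 0 < g' t) :
    False := by
  obtain ⟨ε, hε, hball⟩ := Metric.eventually_nhds_iff.1 (hmax.and hg)
  obtain ⟨η, hη, hηpos⟩ := mem_nhdsGT_iff_exists_Ioo_subset.1 hpos
  have hη0 : (0 : ℝ) < η := hη
  set d := min (ε / 2) (η / 2) with hd
  have hd0 : 0 < d := by positivity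
  have hdε : d < ε := by have := min_le_left (ε / 2) (η / 2); linarith
  have hdη : d < η := by have := min_le_right (ε / 2) (η / 2); linarith
  have hin : ∀ t ∈ Set.Icc 0 d, dist t 0 < ε := by
    intro t ht
    rw [Real.dist_eq, sub_zero, abs_of_nonneg ht.1]
    exact ht.2.trans_lt hdε
  have hmono : StrictMonoOn g (Set.Icc 0 d) := by
    refine strictMonoOn_of_deriv_pos (convex_Icc 0 d)
      (fun t ht => (hball (hin t ht)).2.continuousAt.continuousWithinAt) fun t ht => ?_
    rw [interior_Icc] at ht
    rw [(hball (hin t ⟨ht.1.le, ht.2.le⟩)).2.deriv]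
    exact hηpos ⟨ht.1, ht.2.trans hdη⟩
  have h1 := hmono ⟨le_rfl, hd0.le⟩ ⟨hd0.le, le_rfl⟩ hd0
  have h2 := (hball (hin d ⟨hd0.le, le_rfl⟩)).1
  exact absurd h1 (not_lt.2 h2)

theorem second_deriv_nonpos_of_isLocalMax {g g' : ℝ → ℝ} {c : ℝ} (hmax : IsLocalMax g 0)
    (hg : ∀ᶠ t in 𝓝 (0 : ℝ), HasDerivAt g (g' t) t) (hg' : HasDerivAt g' c 0) : c ≤ 0 := by
  by_contra! hc
  have h0 : g' 0 = 0 := hmax.hasDerivAt_eq_zero hg.self_of_nhds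
  refine not_isLocalMax_of_eventually_deriv_pos hmax hg ?_
  have h1 := (hasDerivAt_iff_tendsto_slope.1 hg').eventually (lt_mem_nhds hc)
  have h2 : ∀ᶠ t in 𝓝[>] (0 : ℝ), 0 < slope g' 0 t :=
    h1.filter_mono (nhdsWithin_mono 0 fun t ht => ne_of_gt ht)
  filter_upwards [h2, self_mem_nhdsWithin] with t ht ht0
  rw [slope_def_field, h0, sub_zero, sub_zero] at ht
  have ht0' : (0 : ℝ) < t := ht0
  exact (div_pos_iff_of_pos_right ht0').1 ht

section

variable {n : ℕ}

theorem gradient_eq_toDual_symm_comp (u : EuclideanSpace ℝ (Fin n) → ℝ) :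
    ∇ u = fun x => (InnerProductSpace.toDual ℝ (EuclideanSpace ℝ (Fin n))).symm (fderiv ℝ u x) :=
  rfl

theorem differentiableAt_gradient {u : EuclideanSpace ℝ (Fin n) → ℝ}
    {x : EuclideanSpace ℝ (Fin n)} (hu : ContDiffAt ℝ 2 u x) : DifferentiableAt ℝ (∇ u) x := by
  have h1 : DifferentiableAt ℝ (fderiv ℝ u) x :=
    (hu.fderiv_right (m := 1) (by norm_num)).differentiableAt (by norm_num)
  rw [gradient_eq_toDual_symm_comp]
  exact ((InnerProductSpace.toDual ℝ
    (EuclideanSpace ℝ (Fin n))).symm.toContinuousLinearEquiv.differentiableAt).comp x h1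

theorem inner_fderiv_gradient_eq {u : EuclideanSpace ℝ (Fin n) → ℝ}
    {x : EuclideanSpace ℝ (Fin n)} (hu : ContDiffAt ℝ 2 u x) (v w : EuclideanSpace ℝ (Fin n)) :
    ⟪fderiv ℝ (∇ u) x v, w⟫ = fderiv ℝ (fderiv ℝ u) x v w := by
  have h1 : DifferentiableAt ℝ (fderiv ℝ u) x :=
    (hu.fderiv_right (m := 1) (by norm_num)).differentiableAt (by norm_num)
  have h2 : HasFDerivAt (fun y => ⟪w, ∇ u y⟫) ((innerSL ℝ w).comp (fderiv ℝ (∇ u) x)) x :=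
    (innerSL ℝ w).hasFDerivAt.comp x (differentiableAt_gradient hu).hasFDerivAt
  have h3 : HasFDerivAt (fun y => fderiv ℝ u y w)
      ((ContinuousLinearMap.apply ℝ ℝ w).comp (fderiv ℝ (fderiv ℝ u) x)) x :=
    (ContinuousLinearMap.apply ℝ ℝ w).hasFDerivAt.comp x h1.hasFDerivAt
  have e : (fun y => ⟪w, ∇ u y⟫) = fun y => fderiv ℝ u y w := by
    funext y
    rw [real_inner_comm, inner_gradient_left]
  rw [e] at h2
  have h4 := congrArg (fun L => L v) (h2.unique h3)
  rw [real_inner_comm]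
  exact h4

theorem inner_fderiv_gradient_comm {u : EuclideanSpace ℝ (Fin n) → ℝ}
    {x : EuclideanSpace ℝ (Fin n)} (hu : ContDiffAt ℝ 2 u x) (v w : EuclideanSpace ℝ (Fin n)) :
    ⟪fderiv ℝ (∇ u) x v, w⟫ = ⟪fderiv ℝ (∇ u) x w, v⟫ := by
  rw [inner_fderiv_gradient_eq hu, inner_fderiv_gradient_eq hu]
  exact (hu.isSymmSndFDerivAt (by simp)).eq v w

theorem hasDerivAt_comp_line {u : EuclideanSpace ℝ (Fin n) → ℝ} {x h : EuclideanSpace ℝ (Fin n)}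
    {t : ℝ} (hu : DifferentiableAt ℝ u (x + t • h)) :
    HasDerivAt (fun s : ℝ => u (x + s • h)) ⟪∇ u (x + t • h), h⟫ t := by
  have h1 : HasDerivAt (fun s : ℝ => x + s • h) h t := by
    simpa using ((hasDerivAt_id t).smul_const h).const_add x
  have h2 := hu.hasFDerivAt.comp_hasDerivAt t h1
  rw [inner_gradient_left]
  exact h2

theorem tendsto_add_smul_nhds_zero (x h : EuclideanSpace ℝ (Fin n)) :
    Tendsto (fun t : ℝ => x + t • h) (𝓝 0) (𝓝 x) := by
  have : Continuous fun t : ℝ => x + t • h := by fun_prop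
  simpa using this.tendsto 0

theorem trace_eq_sum_of_isEigenvalueVector {A : Matrix (Fin n) (Fin n) ℝ} {l : Fin n → ℝ}
    (hl : IsEigenvalueVector A l) : A.trace = ∑ i, l i := by
  rw [Matrix.trace_eq_sum_roots_charpoly_of_splits, hl, Polynomial.roots_prod]
  · simp [List.sum_ofFn]
  · simp [Finset.prod_ne_zero_iff, Polynomial.X_sub_C_ne_zero]
  · rw [hl]
    exact Polynomial.Splits.prod fun i _ => Polynomial.Splits.X_sub_C _

/-- A positive trace of `D(|Du|^{p-2}Du)` excludes local maxima. -/
theorem not_isLocalMax_of_trace_pos {p : ℝ} {u : EuclideanSpace ℝ (Fin n) → ℝ}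
    {x : EuclideanSpace ℝ (Fin n)} (hu : Differentiable ℝ u)
    (hd : DifferentiableAt ℝ (pGradient p u) x) (htr : 0 < (pHessian p u x).trace) :
    ¬ IsLocalMax u x := by
  intro hmax
  have hgrad : ∇ u x = 0 := by
    rw [gradient_eq_toDual_symm_comp]
    simp [hmax.fderiv_eq_zero]
  obtain ⟨i, -, hi⟩ := Finset.exists_lt_of_sum_lt
    (s := Finset.univ) (f := fun _ => (0 : ℝ)) (g := fun i => pHessian p u x i i)
    (by simpa [Matrix.trace] using htr)
  set h : EuclideanSpace ℝ (Fin n) := EuclideanSpace.single i 1 with hh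
  have hline := tendsto_add_smul_nhds_zero x h
  have hmax0 : IsLocalMax (fun t : ℝ => u (x + t • h)) 0 := by
    have := hline.eventually hmax
    simpa [IsLocalMax, IsMaxFilter] using this
  refine not_isLocalMax_of_eventually_deriv_pos hmax0
    (Eventually.of_forall fun t => hasDerivAt_comp_line hu.differentiableAt) ?_
  have h1 : HasDerivAt (fun s : ℝ => x + s • h) h 0 := by
    simpa using ((hasDerivAt_id (0 : ℝ)).smul_const h).const_add x
  have h2 : HasDerivAt (fun s : ℝ => pGradient p u (x + s • h))
      (fderiv ℝ (pGradient p u) x h) 0 := by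
    have hd' : HasFDerivAt (pGradient p u) (fderiv ℝ (pGradient p u) x) (x + (0 : ℝ) • h) := by
      simpa using hd.hasFDerivAt
    exact hd'.comp_hasDerivAt 0 h1
  have h3 : HasDerivAt (fun s : ℝ => ⟪pGradient p u (x + s • h), h⟫)
      (pHessian p u x i i) 0 := by
    have := h2.inner ℝ (hasDerivAt_const 0 h)
    have e : pHessian p u x i i = ⟪fderiv ℝ (pGradient p u) x h, h⟫ := by
      rw [hh, EuclideanSpace.inner_single_right]; simp [pHessian]
    rw [e]
    simpa using this
  -- `|Du|^{p-2}Du` vanishes at `x`, so a positive diagonal entry makes its i-th component positive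
  -- just after `x`. The factor `|Du|^{p-2}` is nonnegative, so `D_i u > 0` there and `u` increases
  -- along `e_i`. No second derivative of `u` at `x` is used.
  have h4 := (hasDerivAt_iff_tendsto_slope.1 h3).eventually (lt_mem_nhds hi)
  have h5 : ∀ᶠ t in 𝓝[>] (0 : ℝ), 0 < slope (fun s : ℝ => ⟪pGradient p u (x + s • h), h⟫) 0 t :=
    h4.filter_mono (nhdsWithin_mono 0 fun t ht => ne_of_gt ht)
  filter_upwards [h5, self_mem_nhdsWithin] with t ht ht0
  have ht0' : (0 : ℝ) < t := ht0
  simp only [slope_def_field, zero_smul, add_zero, sub_zero] at ht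
  have hz : pGradient p u x = 0 := by simp [pGradient, hgrad]
  rw [hz, inner_zero_left, sub_zero, div_pos_iff_of_pos_right ht0', pGradient,
    real_inner_smul_left] at ht
  exact pos_of_mul_pos_right ht (by positivity)

/-- Differentiating the factor `|Du|^{p-2}` contributes the rank-one term. The sign of `s` is free
because both increasing and decreasing radial barriers touch `u` later. -/
theorem pHessian_eq_of_gradient_ne_zero {p : ℝ} {u : EuclideanSpace ℝ (Fin n) → ℝ}
    {x ν : EuclideanSpace ℝ (Fin n)} {s : ℝ} (hu : ContDiffAt ℝ 2 u x)
    (hν : ‖ν‖ = 1) (hs : s ≠ 0) (hgrad : ∇ u x = s • ν) :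
    pHessian p u x = |s| ^ (p - 2) •
      ((Matrix.of fun i j : Fin n => ⟪fderiv ℝ (∇ u) x (EuclideanSpace.single i 1),
          EuclideanSpace.single j 1⟫) * (1 + (p - 2) • Matrix.vecMulVec ν ν)) := by
  have hd := (differentiableAt_gradient hu).hasFDerivAt
  have hnorm : ‖∇ u x‖ = |s| := by rw [hgrad, norm_smul, hν, mul_one, Real.norm_eq_abs]
  have hsq : HasFDerivAt (fun y => ‖∇ u y‖ ^ 2)
      (2 • (innerSL ℝ (∇ u x)).comp (fderiv ℝ (∇ u) x)) x := hd.norm_sq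
  have habs : 0 < |s| := abs_pos.2 hs
  have hpow : HasFDerivAt (fun y => ‖∇ u y‖ ^ (p - 2))
      (((p - 2) / 2 * (|s| ^ 2) ^ ((p - 2) / 2 - 1)) •
        (2 • (innerSL ℝ (∇ u x)).comp (fderiv ℝ (∇ u) x))) x := by
    have h1 := hsq.rpow_const (p := (p - 2) / 2) (Or.inl (by rw [hnorm]; positivity))
    rw [hnorm] at h1
    refine h1.congr_of_eventuallyEq (Eventually.of_forall fun y => ?_)
    show ‖∇ u y‖ ^ (p - 2) = (‖∇ u y‖ ^ 2) ^ ((p - 2) / 2)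
    rw [← Real.rpow_natCast, ← Real.rpow_mul (norm_nonneg _)]
    congr 1; push_cast; ring
  have hF : HasFDerivAt (pGradient p u) _ x := hpow.smul hd
  ext i j
  rw [pHessian, Matrix.of_apply, hF.fderiv]
  have hc : (|s| ^ 2) ^ ((p - 2) / 2 - 1) * s ^ 2 = |s| ^ (p - 2) := by
    rw [← sq_abs s]
    conv_lhs => rw [← Real.rpow_one (|s| ^ 2), ← Real.rpow_mul (by positivity),
      ← Real.rpow_add (by positivity)]
    rw [← Real.rpow_natCast, ← Real.rpow_mul habs.le]
    congr 1; push_cast; ring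
  set D := fderiv ℝ (∇ u) x (EuclideanSpace.single i 1) with hD
  have hmat : ((Matrix.of fun i j : Fin n => ⟪fderiv ℝ (∇ u) x (EuclideanSpace.single i 1),
      EuclideanSpace.single j 1⟫) * (1 + (p - 2) • Matrix.vecMulVec (ν : Fin n → ℝ) ν)) i j =
      D j + (p - 2) * (⟪ν, D⟫ * ν j) := by
    rw [mul_add, mul_one, Matrix.add_apply, mul_smul_comm, Matrix.smul_apply, Matrix.mul_apply,
      smul_eq_mul]
    congr 1
    · rw [Matrix.of_apply, EuclideanSpace.inner_single_right]; simp [hD]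
    · congr 1
      rw [PiLp.inner_apply, Finset.sum_mul]
      refine Finset.sum_congr rfl fun m _ => ?_
      rw [Matrix.of_apply, EuclideanSpace.inner_single_right, Matrix.vecMulVec_apply]
      simp [hD]; ring
  rw [Matrix.smul_apply, hmat, smul_eq_mul, hnorm]
  simp only [_root_.add_apply, _root_.smul_apply, PiLp.add_apply,
    PiLp.smul_apply, ContinuousLinearMap.smulRight_apply, ContinuousLinearMap.comp_apply,
    innerSL_apply_apply, smul_eq_mul, hgrad, real_inner_smul_left, nsmul_eq_mul, ← hD]
  rw [← hc]
  push_cast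
  ring

/-- Eigenvalue bounds at a point where `u` is touched from above. -/
theorem exists_symPoly_eq_of_hessian_le {p : ℝ} (hp : 1 < p) {u : EuclideanSpace ℝ (Fin n) → ℝ}
    {x ν : EuclideanSpace ℝ (Fin n)} {s A B : ℝ} (hu : ContDiffAt ℝ 2 u x)
    (hν : ‖ν‖ = 1) (hs : s ≠ 0) (hgrad : ∇ u x = s • ν)
    (hquad : ∀ h, ⟪fderiv ℝ (∇ u) x h, h⟫ ≤ A * ⟪ν, h⟫ ^ 2 + B * (‖h‖ ^ 2 - ⟪ν, h⟫ ^ 2))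
    {l : Fin n → ℝ} (hl : IsEigenvalueVector (pHessian p u x) l) :
    ∃ l' : Fin n → ℝ, (∀ j, symPoly j l' = symPoly j l) ∧
      (∀ i, l' i ≤ max (|s| ^ (p - 2) * (p - 1) * A) (|s| ^ (p - 2) * B)) ∧
      ∀ i j, i ≠ j → l' i ≤ |s| ^ (p - 2) * B ∨ l' j ≤ |s| ^ (p - 2) * B := by
  rw [pHessian_eq_of_gradient_ne_zero hu hν hs hgrad] at hl
  refine exists_symPoly_eq_of_quadratic_le _ ?_ ν ?_ _ p A B (by positivity) hp ?_ hl
  · ext i j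
    exact inner_fderiv_gradient_comm hu _ _
  · have := EuclideanSpace.real_norm_sq_eq ν
    rw [hν] at this
    simp only [dotProduct, ← sq]
    rw [← this]; norm_num
  · intro h
    have h0 := hquad (WithLp.toLp 2 h)
    have e1 : ⟪ν, WithLp.toLp 2 h⟫ = ν ⬝ᵥ h := by
      rw [EuclideanSpace.inner_eq_star_dotProduct, dotProduct_comm]; simp
    have e2 : ‖(WithLp.toLp 2 h : EuclideanSpace ℝ (Fin n))‖ ^ 2 = h ⬝ᵥ h := by
      rw [EuclideanSpace.real_norm_sq_eq]; simp [dotProduct, sq]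
    have hsum : (WithLp.toLp 2 h : EuclideanSpace ℝ (Fin n)) =
        ∑ i, h i • EuclideanSpace.single i (1 : ℝ) := by
      ext j; simp [Finset.sum_apply, Pi.single_apply]
    have e3 : ⟪fderiv ℝ (∇ u) x (WithLp.toLp 2 h), WithLp.toLp 2 h⟫ =
        h ⬝ᵥ ((Matrix.of fun i j : Fin n => ⟪fderiv ℝ (∇ u) x (EuclideanSpace.single i 1),
          EuclideanSpace.single j 1⟫).mulVec h) := by
      rw [hsum, map_sum, sum_inner]
      simp only [inner_sum, dotProduct, Matrix.mulVec, map_smul, real_inner_smul_left,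
        real_inner_smul_right, Matrix.of_apply]
      refine Finset.sum_congr rfl fun i _ => ?_
      rw [Finset.mul_sum]
      refine Finset.sum_congr rfl fun j _ => ?_
      ring
    rw [e1, e2, e3] at h0
    exact h0

end

/-! ### Touching by radial barriers. -/

section

variable {n : ℕ}

theorem hasDerivAt_norm_add_smul {x h : EuclideanSpace ℝ (Fin n)} {t : ℝ} (hx : x + t • h ≠ 0) :
    HasDerivAt (fun s : ℝ => ‖x + s • h‖) (⟪x + t • h, h⟫ / ‖x + t • h‖) t := by
  have h1 : HasDerivAt (fun s : ℝ => x + s • h) h t := by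
    simpa using ((hasDerivAt_id t).smul_const h).const_add x
  have h2 := h1.norm_sq.sqrt (by simpa using hx)
  simp only [Real.sqrt_sq (norm_nonneg _)] at h2
  convert h2 using 1
  rw [mul_div_mul_left _ _ (by norm_num)]

theorem hasDerivAt_inner_div_norm {x h : EuclideanSpace ℝ (Fin n)} (hx : x ≠ 0) :
    HasDerivAt (fun s : ℝ => ⟪x + s • h, h⟫ / ‖x + s • h‖)
      ((‖h‖ ^ 2 - ⟪‖x‖⁻¹ • x, h⟫ ^ 2) / ‖x‖) 0 := by
  have h1 : HasDerivAt (fun s : ℝ => x + s • h) h 0 := by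
    simpa using ((hasDerivAt_id (0 : ℝ)).smul_const h).const_add x
  have h2 : HasDerivAt (fun s : ℝ => ⟪x + s • h, h⟫) (⟪h, h⟫) 0 := by
    simpa using h1.inner ℝ (hasDerivAt_const 0 h)
  have hx' : x + (0 : ℝ) • h ≠ 0 := by simpa using hx
  have h3 := h2.div (hasDerivAt_norm_add_smul hx') (norm_ne_zero_iff.2 hx')
  have hxn : ‖x‖ ≠ 0 := norm_ne_zero_iff.2 hx
  refine h3.congr_deriv ?_
  simp only [zero_smul, add_zero, real_inner_smul_left, real_inner_self_eq_norm_sq]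
  field_simp

/-- First and second order conditions at a maximum of `T ∘ u - δ|x|`. -/
theorem gradient_and_hessian_of_isLocalMax_sub_norm {u : EuclideanSpace ℝ (Fin n) → ℝ}
    {x : EuclideanSpace ℝ (Fin n)} (hu : Differentiable ℝ u) (hu2 : ContDiffAt ℝ 2 u x)
    (hx : x ≠ 0) {T T' : ℝ → ℝ} {T'' δ : ℝ} (hT : ∀ᶠ s in 𝓝 (u x), HasDerivAt T (T' s) s)
    (hT' : HasDerivAt T' T'' (u x)) (hpos : 0 < T' (u x))
    (hmax : IsLocalMax (fun y => T (u y) - δ * ‖y‖) x) :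
    ∇ u x = (δ / T' (u x)) • (‖x‖⁻¹ • x) ∧
    ∀ h, ⟪fderiv ℝ (∇ u) x h, h⟫ ≤
      (-(T'' / T' (u x)) * (δ / T' (u x)) ^ 2) * ⟪‖x‖⁻¹ • x, h⟫ ^ 2 +
        (δ / T' (u x) / ‖x‖) * (‖h‖ ^ 2 - ⟪‖x‖⁻¹ • x, h⟫ ^ 2) := by
  have hline := tendsto_add_smul_nhds_zero x
  have hmax0 : ∀ h, IsLocalMax (fun t : ℝ => T (u (x + t • h)) - δ * ‖x + t • h‖) 0 := by
    intro h
    have := (hline h).eventually hmax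
    simpa [IsLocalMax, IsMaxFilter] using this
  have hne : ∀ h, ∀ᶠ t in 𝓝 (0 : ℝ), x + t • h ≠ 0 := fun h =>
    (hline h).eventually (isOpen_ne.mem_nhds hx)
  have hder : ∀ h, ∀ᶠ t in 𝓝 (0 : ℝ),
      HasDerivAt (fun t : ℝ => T (u (x + t • h)) - δ * ‖x + t • h‖)
        (T' (u (x + t • h)) * ⟪∇ u (x + t • h), h⟫ -
          δ * (⟪x + t • h, h⟫ / ‖x + t • h‖)) t := by
    intro h
    have h1 : Tendsto (fun t : ℝ => u (x + t • h)) (𝓝 0) (𝓝 (u x)) :=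
      (hu.continuous.tendsto x).comp (hline h)
    filter_upwards [hne h, h1.eventually hT] with t ht htT
    exact (htT.comp t (hasDerivAt_comp_line hu.differentiableAt)).sub
      ((hasDerivAt_norm_add_smul ht).const_mul δ)
  have hgrad : ∇ u x = (δ / T' (u x)) • (‖x‖⁻¹ • x) := by
    refine ext_inner_right ℝ fun h => ?_
    have := (hmax0 h).hasDerivAt_eq_zero (hder h).self_of_nhds
    simp only [zero_smul, add_zero] at this
    rw [real_inner_smul_left, real_inner_smul_left]
    have hxn : ‖x‖ ≠ 0 := norm_ne_zero_iff.2 hx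
    field_simp at this ⊢
    linarith
  refine ⟨hgrad, fun h => ?_⟩
  have h1 : HasDerivAt (fun s : ℝ => x + s • h) h 0 := by
    simpa using ((hasDerivAt_id (0 : ℝ)).smul_const h).const_add x
  have h2 : HasDerivAt (fun t : ℝ => ⟪∇ u (x + t • h), h⟫) ⟪fderiv ℝ (∇ u) x h, h⟫ 0 := by
    have hd' : HasFDerivAt (∇ u) (fderiv ℝ (∇ u) x) (x + (0 : ℝ) • h) := by
      simpa using (differentiableAt_gradient hu2).hasFDerivAt
    simpa using (hd'.comp_hasDerivAt 0 h1).inner ℝ (hasDerivAt_const 0 h)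
  have h3 : HasDerivAt (fun t : ℝ => T' (u (x + t • h))) (T'' * ⟪∇ u x, h⟫) 0 := by
    have hu' : HasDerivAt (fun s : ℝ => u (x + s • h)) ⟪∇ u x, h⟫ 0 := by
      have := hasDerivAt_comp_line (t := 0) (h := h) (x := x) (u := u) hu.differentiableAt
      simpa using this
    have hT0 : HasDerivAt T' T'' (u (x + (0 : ℝ) • h)) := by simpa using hT'
    exact HasDerivAt.comp (0 : ℝ) hT0 hu'
  have h4 := second_deriv_nonpos_of_isLocalMax (hmax0 h) (hder h)
    ((h3.mul h2).sub ((hasDerivAt_inner_div_norm hx).const_mul δ))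
  simp only [zero_smul, add_zero] at h4
  have h5 : ⟪∇ u x, h⟫ = δ / T' (u x) * ⟪‖x‖⁻¹ • x, h⟫ := by
    rw [hgrad, real_inner_smul_left]
  rw [h5] at h4
  have hxn : 0 < ‖x‖ := norm_pos_iff.2 hx
  have h6 : ⟪fderiv ℝ (∇ u) x h, h⟫ * T' (u x) ≤
      δ * ((‖h‖ ^ 2 - ⟪‖x‖⁻¹ • x, h⟫ ^ 2) / ‖x‖) -
        T'' * (δ / T' (u x) * ⟪‖x‖⁻¹ • x, h⟫) * (δ / T' (u x) * ⟪‖x‖⁻¹ • x, h⟫) := by linarith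
  have h7 := (le_div_iff₀ hpos).2 h6
  refine h7.trans (le_of_eq ?_)
  field_simp
  ring

/-- An admissible function is not bounded on `∂B_2` by its maximum on `∂B_1`. -/
theorem exists_sphere_one_lt_sphere_two {k : ℕ} (hn : 1 ≤ n) (hk : 1 ≤ k) {p α β : ℝ} (hp : 1 < p)
    {f : ℝ → ℝ} {u : EuclideanSpace ℝ (Fin n) → ℝ}
    (hu : IsEntireAdmissibleSubsolution k p α β f u) :
    ∃ (m : ℝ) (y : EuclideanSpace ℝ (Fin n)), ‖y‖ = 2 ∧ m < u y ∧ ∀ x, ‖x‖ = 1 → u x ≤ m := by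
  have hdiff : Differentiable ℝ u := hu.contDiff_one.differentiable (by norm_num)
  have hcont := hdiff.continuous
  have hno : ∀ x, x ≠ 0 → ¬ IsLocalMax u x := by
    intro x hx
    obtain ⟨hd, -, l, hl, hlΓ, -⟩ := hu.subsolution x hx
    refine not_isLocalMax_of_trace_pos hdiff hd ?_
    rw [trace_eq_sum_of_isEigenvalueVector hl, ← symPoly_one]
    exact hlΓ 1 le_rfl hk
  have : Nonempty (Fin n) := ⟨⟨0, hn⟩⟩
  have hsph : ∀ r : ℝ, 0 ≤ r → (Metric.sphere (0 : EuclideanSpace ℝ (Fin n)) r).Nonempty :=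
    fun r hr => NormedSpace.sphere_nonempty.2 hr
  obtain ⟨y₀, hy₀, hy₀max⟩ := (isCompact_sphere (0 : EuclideanSpace ℝ (Fin n)) 1).exists_isMaxOn
    (hsph 1 zero_le_one) hcont.continuousOn
  obtain ⟨y, hy, hymax⟩ := (isCompact_sphere (0 : EuclideanSpace ℝ (Fin n)) 2).exists_isMaxOn
    (hsph 2 zero_le_two) hcont.continuousOn
  rw [mem_sphere_zero_iff_norm] at hy₀ hy
  by_cases hlt : u y₀ < u y
  · exact ⟨u y₀, y, hy, hlt, fun x hx => hy₀max (mem_sphere_zero_iff_norm.2 hx)⟩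
  exfalso
  push Not at hlt
  have hball : ∀ z : EuclideanSpace ℝ (Fin n), ‖z‖ < 2 →
      Metric.closedBall (0 : EuclideanSpace ℝ (Fin n)) 2 ∈ 𝓝 z := fun z hz =>
    mem_of_superset (Metric.isOpen_ball.mem_nhds (mem_ball_zero_iff.2 hz)) Metric.ball_subset_closedBall
  have hy₀0 : y₀ ≠ 0 := by rw [← norm_ne_zero_iff, hy₀]; norm_num
  -- As no point off the origin is a local maximum, the maximum over the ball of radius 2 exceeds `u
  -- y₀`, is not on the boundary sphere, and so can only sit at the origin.
  obtain ⟨z, hz, hzmax⟩ :=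
    (isCompact_closedBall (0 : EuclideanSpace ℝ (Fin n)) 2).exists_isMaxOn
      ⟨0, by simp⟩ hcont.continuousOn
  have hnoty₀ : ¬ IsMaxOn u (Metric.closedBall 0 2) y₀ := fun h =>
    hno y₀ hy₀0 (h.isLocalMax (hball y₀ (by rw [hy₀]; norm_num)))
  have hy₀z : u y₀ < u z := by
    by_contra! hle
    exact hnoty₀ fun x hx => (hzmax hx).trans hle
  have hz2 : ‖z‖ < 2 := by
    refine lt_of_le_of_ne (mem_closedBall_zero_iff.1 hz) fun h => ?_
    have : u z ≤ u y := hymax (mem_sphere_zero_iff_norm.2 h)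
    linarith
  have hzloc : IsLocalMax u z := hzmax.isLocalMax (hball z hz2)
  have hz0 : z = 0 := by
    by_contra h
    exact hno z h hzloc
  subst hz0
  -- Half the gap, so that `u + B|x| ≤ u y₀ + 2B = u 0` on `|x| = 2`. Since `Du(0) = 0`, the cone
  -- `B|x|` pushes the maximum of `u + B|x|` off the origin, so it is attained at some `w` with `0 <
  -- |w| < 2`.
  set B := (u 0 - u y₀) / 2 with hB
  have hBpos : 0 < B := by linarith
  obtain ⟨w, hw, hwmax⟩ :=
    (isCompact_closedBall (0 : EuclideanSpace ℝ (Fin n)) 2).exists_isMaxOn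
      ⟨0, by simp⟩ (f := fun x => u x - -B * ‖x‖) (by fun_prop)
  have hwgt : u 0 < u w - -B * ‖w‖ := by
    have h1 : HasDerivAt (fun t : ℝ => u (0 + t • y₀)) 0 0 := by
      have := hasDerivAt_comp_line (t := 0) (h := y₀) (x := 0) (u := u) hdiff.differentiableAt
      rw [inner_gradient_left] at this
      simpa [hzloc.fderiv_eq_zero] using this
    have h2 := (hasDerivAt_iff_tendsto_slope.1 h1).eventually
      (lt_mem_nhds (show -B < 0 by linarith))
    have h3 : ∀ᶠ t in 𝓝[>] (0 : ℝ), -B < slope (fun t : ℝ => u (0 + t • y₀)) 0 t :=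
      h2.filter_mono (nhdsWithin_mono 0 fun t ht => ne_of_gt ht)
    obtain ⟨t, ht, ht01⟩ := (h3.and (Ioo_mem_nhdsGT (zero_lt_one' ℝ))).exists
    rw [slope_def_field, sub_zero, lt_div_iff₀ ht01.1] at ht
    simp only [zero_add, zero_smul] at ht
    have hnt : ‖t • y₀‖ = t := by rw [norm_smul, hy₀, mul_one, Real.norm_of_nonneg ht01.1.le]
    have h4 : u (t • y₀) - -B * ‖t • y₀‖ ≤ u w - -B * ‖w‖ := by
      refine hwmax (mem_closedBall_zero_iff.2 ?_)
      rw [hnt]; linarith [ht01.2]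
    rw [hnt] at h4
    linarith
  have hw0 : w ≠ 0 := by
    rintro rfl
    simp at hwgt
  have hw2 : ‖w‖ < 2 := by
    refine lt_of_le_of_ne (mem_closedBall_zero_iff.1 hw) fun h => ?_
    have : u w ≤ u y := hymax (mem_sphere_zero_iff_norm.2 h)
    rw [h] at hwgt
    linarith
  have hcd : ContDiffAt ℝ 2 u w := hu.contDiffOn_two.contDiffAt (isOpen_compl_singleton.mem_nhds hw0)
  obtain ⟨hg, hh⟩ := gradient_and_hessian_of_isLocalMax_sub_norm (T := id) (T' := fun _ => 1)
    (T'' := 0) (δ := -B) hdiff hcd hw0 (Eventually.of_forall fun s => hasDerivAt_id s)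
    (hasDerivAt_const _ _) one_pos (hwmax.isLocalMax (hball w hw2))
  obtain ⟨-, -, l, hl, hlΓ, -⟩ := hu.subsolution w hw0
  have hwn : 0 < ‖w‖ := norm_pos_iff.2 hw0
  obtain ⟨l', hl', hle, -⟩ := exists_symPoly_eq_of_hessian_le hp hcd
    (by rw [norm_smul, norm_inv, norm_norm, inv_mul_cancel₀ hwn.ne'])
    (by simpa using hBpos.ne') hg hh hl
  have h1 := hlΓ 1 le_rfl hk
  rw [← hl', symPoly_one] at h1
  -- At `w` the function `u` is touched from above by a constant minus `B|x|`, which is concave, so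
  -- every eigenvalue is nonpositive, against `S_1 > 0`.
  have h2 : ∑ i, l' i ≤ 0 := by
    refine Finset.sum_nonpos fun i _ => (hle i).trans (max_le (by simp) ?_)
    refine mul_nonpos_of_nonneg_of_nonpos (by positivity) ?_
    rw [div_one]
    exact div_nonpos_of_nonpos_of_nonneg (by linarith) hwn.le
  linarith

end

/-! ### Consequences of a convergent Keller–Osserman integral. -/

theorem intervalIntegral_pos_of_pos {g : ℝ → ℝ} (hg : Continuous g) (hpos : ∀ t, 0 < g t)
    {t : ℝ} (ht : 0 < t) : 0 < ∫ s in (0 : ℝ)..t, g s :=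
  intervalIntegral.intervalIntegral_pos_of_pos (hg.intervalIntegrable _ _) hpos ht

/-- If `∫^∞ (∫_0^t g)^{-e} dt` is finite, so is `∫_m^∞ (1 + ∫_m^t g)^{-e} dt`. -/
theorem exists_bound_integral_rpow {g : ℝ → ℝ} (hg : Continuous g) (hpos : ∀ t, 0 < g t)
    {e a : ℝ} (he : 0 < e) (ha : 0 < a)
    (hfin : ∫⁻ t in Set.Ioi a, ENNReal.ofReal ((∫ s in (0 : ℝ)..t, g s) ^ (-e)) ≠ ⊤) (m : ℝ) :
    ∃ B : ℝ, 0 < B ∧ ∀ s, m ≤ s →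
      ∫ t in m..s, (1 + max (∫ τ in m..t, g τ) 0) ^ (-e) ≤ B := by
  have hint : ∀ a b, IntervalIntegrable g volume a b := fun a b => hg.intervalIntegrable a b
  set G : ℝ → ℝ := fun t => ∫ s in (0 : ℝ)..t, g s with hG
  have hGc : Continuous G := intervalIntegral.continuous_primitive hint 0
  have hHc : Continuous fun t => ∫ τ in m..t, g τ := intervalIntegral.continuous_primitive hint m
  set J : ℝ → ℝ := fun t => (1 + max (∫ τ in m..t, g τ) 0) ^ (-e) with hJ
  have hQpos : ∀ t, 0 < 1 + max (∫ τ in m..t, g τ) 0 := fun t =>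
    add_pos_of_pos_of_nonneg one_pos (le_max_right _ _)
  have hJc : Continuous J :=
    (continuous_const.add (hHc.max continuous_const)).rpow_const fun t => Or.inl (hQpos t).ne'
  have hJpos : ∀ t, 0 < J t := fun t => Real.rpow_pos_of_pos (hQpos t) _
  have hJint : ∀ a b, IntervalIntegrable J volume a b := fun a b => hJc.intervalIntegrable a b
  have hGpos : ∀ t, 0 < t → 0 < G t := fun t ht => intervalIntegral_pos_of_pos hg hpos ht
  have hL : IntegrableOn (fun t => G t ^ (-e)) (Set.Ioi a) := by
    refine (lintegral_ofReal_ne_top_iff_integrable ?_ ?_).1 hfin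
    · exact (hGc.measurable.pow_const _).aestronglyMeasurable
    · filter_upwards [ae_restrict_mem measurableSet_Ioi] with t ht
      exact Real.rpow_nonneg (hGpos t (ha.trans ht)).le _
  set b := max a m with hb
  set c := 1 + |G m| with hc
  have hcpos : 0 < c := by positivity
  have hcomp : ∀ t, b ≤ t → J t ≤ c ^ e * G t ^ (-e) := by
    intro t ht
    have htp : 0 < G t := hGpos t (ha.trans_le ((le_max_left a m).trans ht))
    -- Moving the lower limit from 0 to `m` changes the primitive by the constant `G m`, which the
    -- factor `c` absorbs because the bracket is at least 1.
    have h1 : G t ≤ c * (1 + max (∫ τ in m..t, g τ) 0) := by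
      have h2 : G t = G m + ∫ τ in m..t, g τ :=
        (intervalIntegral.integral_add_adjacent_intervals (hint 0 m) (hint m t)).symm
      have h3 := le_abs_self (G m)
      have h4 := le_max_left (∫ τ in m..t, g τ) 0
      have h5 := le_max_right (∫ τ in m..t, g τ) 0
      have h6 := mul_nonneg (abs_nonneg (G m)) h5
      rw [hc]; nlinarith
    have h7 : G t / c ≤ 1 + max (∫ τ in m..t, g τ) 0 := by rwa [div_le_iff₀' hcpos]
    calc J t ≤ (G t / c) ^ (-e) :=
          Real.rpow_le_rpow_of_nonpos (by positivity) h7 (by linarith)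
      _ = c ^ e * G t ^ (-e) := by
          rw [Real.div_rpow htp.le hcpos.le, Real.rpow_neg hcpos.le, div_inv_eq_mul, mul_comm]
  have hL0 : 0 ≤ ∫ t in Set.Ioi a, G t ^ (-e) :=
    setIntegral_nonneg measurableSet_Ioi fun t ht => Real.rpow_nonneg (hGpos t (ha.trans ht)).le _
  have hTb : 0 ≤ ∫ t in m..b, J t :=
    intervalIntegral.integral_nonneg (le_max_right a m) fun t _ => (hJpos t).le
  refine ⟨1 + (∫ t in m..b, J t) + c ^ e * ∫ t in Set.Ioi a, G t ^ (-e), by positivity, ?_⟩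
  intro s hs
  rcases le_total s b with hsb | hbs
  · have h1 : ∫ t in m..s, J t ≤ ∫ t in m..b, J t :=
      intervalIntegral.integral_mono_interval le_rfl hs hsb
        (Eventually.of_forall fun t => (hJpos t).le) (hJint m b)
    have h2 : 0 ≤ c ^ e * ∫ t in Set.Ioi a, G t ^ (-e) := by positivity
    linarith
  · have h1 : ∫ t in b..s, J t ≤ c ^ e * ∫ t in Set.Ioi a, G t ^ (-e) := by
      rw [intervalIntegral.integral_of_le hbs, ← integral_const_mul]
      have hsub : Set.Ioc b s ⊆ Set.Ioi a := fun t ht => (le_max_left a m).trans_lt ht.1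
      calc ∫ t in Set.Ioc b s, J t ≤ ∫ t in Set.Ioc b s, c ^ e * G t ^ (-e) :=
            setIntegral_mono_on ((hJint b s).1) ((hL.mono_set hsub).const_mul _)
              measurableSet_Ioc fun t ht => hcomp t ht.1.le
        _ ≤ _ := by
            refine setIntegral_mono_set (hL.const_mul _) ?_ hsub.eventuallyLE
            filter_upwards [ae_restrict_mem measurableSet_Ioi] with t ht
            have := Real.rpow_nonneg (hGpos t (ha.trans ht)).le (-e)
            positivity
    have h2 := intervalIntegral.integral_add_adjacent_intervals (hJint m b) (hJint b s)
    linarith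

/-- Growth of `g` forced by the finiteness of `∫_m^∞ (1 + ∫_m^t g)^{-e} dt`. -/
theorem rpow_one_sub_le_mul_of_bound {g : ℝ → ℝ} (hg : Continuous g) (hmono : Monotone g)
    (hpos : ∀ t, 0 < g t) {e m B s : ℝ} (he : 0 < e) (hs : m ≤ s)
    (hB : ∫ t in m..s, (1 + max (∫ τ in m..t, g τ) 0) ^ (-e) ≤ B) :
    (1 + max (∫ τ in m..s, g τ) 0) ^ (1 - e) ≤ (1 / g m + B) * g s := by
  have hint : ∀ a b, IntervalIntegrable g volume a b := fun a b => hg.intervalIntegrable a b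
  have hHc : Continuous fun t => ∫ τ in m..t, g τ := intervalIntegral.continuous_primitive hint m
  have hQpos : ∀ t, 0 < 1 + max (∫ τ in m..t, g τ) 0 := fun t =>
    add_pos_of_pos_of_nonneg one_pos (le_max_right _ _)
  have hJc : Continuous fun t => (1 + max (∫ τ in m..t, g τ) 0) ^ (-e) :=
    (continuous_const.add (hHc.max continuous_const)).rpow_const fun t => Or.inl (hQpos t).ne'
  set Q := 1 + max (∫ τ in m..s, g τ) 0 with hQ
  have hQ0 : 0 < Q := hQpos s
  have hQ1 : 1 ≤ Q := le_add_of_nonneg_right (le_max_right _ _)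
  -- The integrand is non-increasing, so its last value times the length is at most the integral.
  -- Combined with `Q ≤ 1 + (s - m) g s`, which holds by monotonicity of `g`, this trades the length
  -- for a bound on `Q ^ (1 - e)`.
  have h1 : (s - m) * Q ^ (-e) ≤ B := by
    refine le_trans ?_ hB
    have h2 : ∫ t in m..s, Q ^ (-e) ≤ ∫ t in m..s, (1 + max (∫ τ in m..t, g τ) 0) ^ (-e) := by
      refine intervalIntegral.integral_mono_on hs intervalIntegrable_const
        (hJc.intervalIntegrable _ _) fun t ht => ?_
      refine Real.rpow_le_rpow_of_nonpos (hQpos t) ?_ (by linarith)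
      have h3 : ∫ τ in m..t, g τ ≤ ∫ τ in m..s, g τ :=
        intervalIntegral.integral_mono_interval le_rfl ht.1 ht.2
          (Eventually.of_forall fun t => (hpos t).le) (hint m s)
      rw [hQ]
      gcongr
    simpa using h2
  have h4 : ∫ τ in m..s, g τ ≤ (s - m) * g s := by
    have : ∫ τ in m..s, g τ ≤ ∫ τ in m..s, g s :=
      intervalIntegral.integral_mono_on hs (hint m s) intervalIntegrable_const
        fun t ht => hmono ht.2
    simpa using this
  have h5 : Q ≤ 1 + (s - m) * g s := by
    have : 0 ≤ (s - m) * g s := mul_nonneg (by linarith) (hpos s).le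
    rw [hQ]
    gcongr
    exact max_le h4 this
  have hQe : 0 < Q ^ (-e) := Real.rpow_pos_of_pos hQ0 _
  have hQe1 : Q ^ (-e) ≤ 1 := Real.rpow_le_one_of_one_le_of_nonpos hQ1 (by linarith)
  have hgm : 1 ≤ 1 / g m * g s := by
    rw [one_div, inv_mul_eq_div, le_div_iff₀ (hpos m), one_mul]
    exact hmono hs
  calc Q ^ (1 - e) = Q * Q ^ (-e) := by
        rw [sub_eq_add_neg, Real.rpow_add hQ0, Real.rpow_one]
    _ ≤ (1 + (s - m) * g s) * Q ^ (-e) := by gcongr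
    _ = Q ^ (-e) + ((s - m) * Q ^ (-e)) * g s := by ring
    _ ≤ 1 / g m * g s + B * g s := by
        have := (hpos s).le
        gcongr
        exact hQe1.trans hgm
    _ = _ := by ring

/-- The powers of `ψ` match because `k(p-1) = kβ + N - 1`. In the radial term `ψ^N = δ^N Q` cancels
the denominator `Q`; in the tangential term `ψ^{N-1} = δ^{N-1} Q^{1-1/N}` is controlled by `hC`. The
condition on `α` says `-(k-1) ≤ kα`, which handles the powers of `r ≥ 1`. Both remaining exponents
of `δ` are positive, so the last factor is small with `δ`. -/
theorem radial_barrier_estimate {k : ℕ} (hk : 1 ≤ k) {p α β N r ψ g Q δ C : ℝ} (hp : 1 < p)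
    (hα : 1 / (k : ℝ) - 1 ≤ α) (hN : N = k * (p - β - 1) + 1) (hN1 : 1 < N) (hr : 1 ≤ r)
    (hQ : 0 < Q) (hδ : 0 < δ) (hg : 0 < g) (hψ : ψ = δ * Q ^ (1 / N))
    (hC : Q ^ (1 - 1 / N) ≤ C * g) :
    (ψ ^ (p - 2) * (p - 1) * (1 / N * (g / Q) * ψ ^ 2) + ψ ^ (p - 2) * (ψ / r)) *
        (ψ ^ (p - 2) * (ψ / r)) ^ (k - 1) ≤
      (r ^ α * ψ ^ β) ^ k * g * ((p - 1) / N * δ ^ N + C * δ ^ (N - 1)) := by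
  have hN0 : N ≠ 0 := by linarith
  have hψ0 : 0 < ψ := by rw [hψ]; positivity
  have hr0 : 0 < r := by linarith
  have hψN : ψ ^ N = δ ^ N * Q := by
    rw [hψ, Real.mul_rpow hδ.le (by positivity), ← Real.rpow_mul hQ.le, one_div_mul_cancel hN0,
      Real.rpow_one]
  have hψN1 : ψ ^ (N - 1) = δ ^ (N - 1) * Q ^ (1 - 1 / N) := by
    rw [hψ, Real.mul_rpow hδ.le (by positivity), ← Real.rpow_mul hQ.le]
    congr 2; field_simp
  obtain ⟨j, rfl⟩ : ∃ j, k = j + 1 := ⟨k - 1, by omega⟩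
  rw [Nat.add_sub_cancel]
  push_cast at hα hN
  set P := (r ^ α * ψ ^ β) ^ (j + 1) with hP
  have hP0 : 0 < P := by positivity
  have hPe : P = r ^ (α * (j + 1)) * ψ ^ (β * (j + 1)) := by
    rw [hP, mul_pow, ← Real.rpow_natCast, ← Real.rpow_natCast, ← Real.rpow_mul hr0.le,
      ← Real.rpow_mul hψ0.le]
    push_cast; rfl
  have hbe : ψ ^ (p - 2) * (ψ / r) = ψ ^ (p - 1) * r⁻¹ := by
    rw [div_eq_mul_inv, ← mul_assoc]
    nth_rewrite 2 [← Real.rpow_one ψ]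
    rw [← Real.rpow_add hψ0]
    congr 2; ring
  have hbj : (ψ ^ (p - 2) * (ψ / r)) ^ j = ψ ^ ((p - 1) * j) * r ^ (-(j : ℝ)) := by
    rw [hbe, mul_pow, inv_pow, Real.rpow_neg hr0.le, Real.rpow_natCast, Real.rpow_mul hψ0.le,
      Real.rpow_natCast]
  have hrj : r ^ (-(j : ℝ)) ≤ r ^ (α * (j + 1)) := by
    refine Real.rpow_le_rpow_of_exponent_le hr ?_
    have hj : (0 : ℝ) < j + 1 := by positivity
    have := mul_le_mul_of_nonneg_right hα hj.le
    rw [sub_mul, one_div_mul_cancel hj.ne'] at this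
    linarith
  have hrinv : r⁻¹ ≤ 1 := inv_le_one_of_one_le₀ hr
  have h1 : ψ ^ (p - 2) * (p - 1) * (1 / N * (g / Q) * ψ ^ 2) * (ψ ^ (p - 2) * (ψ / r)) ^ j ≤
      P * g * ((p - 1) / N * δ ^ N) := by
    have e1 : ψ ^ (p - 2) * ψ ^ 2 * ψ ^ ((p - 1) * j) = ψ ^ (β * (j + 1)) * (δ ^ N * Q) := by
      rw [← hψN, ← Real.rpow_natCast, ← Real.rpow_add hψ0, ← Real.rpow_add hψ0,
        ← Real.rpow_add hψ0, hN]
      congr 1; push_cast; ring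
    calc _ = ψ ^ (p - 2) * ψ ^ 2 * ψ ^ ((p - 1) * j) * ((p - 1) / N * (g / Q)) *
          r ^ (-(j : ℝ)) := by rw [hbj]; ring
      _ = (ψ ^ (β * (j + 1)) * g * ((p - 1) / N * δ ^ N)) * r ^ (-(j : ℝ)) := by
          rw [e1]; field_simp
      _ ≤ (ψ ^ (β * (j + 1)) * g * ((p - 1) / N * δ ^ N)) * r ^ (α * (j + 1)) := by
          have : 0 ≤ (p - 1) / N := div_nonneg (by linarith) (by linarith)
          gcongr
      _ = _ := by rw [hPe]; ring
  have h2 : ψ ^ (p - 2) * (ψ / r) * (ψ ^ (p - 2) * (ψ / r)) ^ j ≤ P * g * (C * δ ^ (N - 1)) := by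
    have e1 : ψ ^ (p - 1) * ψ ^ ((p - 1) * j) =
        ψ ^ (β * (j + 1)) * (δ ^ (N - 1) * Q ^ (1 - 1 / N)) := by
      rw [← hψN1, ← Real.rpow_add hψ0, ← Real.rpow_add hψ0, hN]
      congr 1; ring
    calc _ = (ψ ^ (p - 1) * ψ ^ ((p - 1) * j)) * r⁻¹ * r ^ (-(j : ℝ)) := by rw [hbj, hbe]; ring
      _ ≤ (ψ ^ (p - 1) * ψ ^ ((p - 1) * j)) * 1 * r ^ (α * (j + 1)) := by gcongr
      _ = ψ ^ (β * (j + 1)) * (δ ^ (N - 1) * Q ^ (1 - 1 / N)) * r ^ (α * (j + 1)) := by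
          rw [e1, mul_one]
      _ ≤ ψ ^ (β * (j + 1)) * (δ ^ (N - 1) * (C * g)) * r ^ (α * (j + 1)) := by gcongr
      _ = _ := by rw [hPe]; ring
  calc _ = _ := add_mul _ _ _
    _ ≤ _ := add_le_add h1 h2
    _ = _ := by ring

/-! ### Necessity of the Keller–Osserman condition. -/

set_option maxHeartbeats 1000000 in
theorem kellerOsserman_of_isEntireAdmissibleSubsolution {n k : ℕ} (hk : 1 ≤ k) (hkn : k ≤ n)
    {p α β : ℝ} {f : ℝ → ℝ} (hf_cont : Continuous f) (hf_mono : Monotone f) (hf_pos : ∀ t, 0 < f t)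
    (hα : 1 / (k : ℝ) - 1 ≤ α) (hβ : β < p - 1) (hp : 1 < p)
    {u : EuclideanSpace ℝ (Fin n) → ℝ} (hu : IsEntireAdmissibleSubsolution k p α β f u) :
    KellerOsserman k p β f := by
  by_contra hKO
  rw [KellerOsserman] at hKO
  push Not at hKO
  obtain ⟨a, ha, hfin⟩ := hKO
  have hk0 : (0 : ℝ) < k := by exact_mod_cast hk
  set N : ℝ := (k : ℝ) * (p - β - 1) + 1 with hN
  have hN1 : 1 < N := by
    have : 0 < (k : ℝ) * (p - β - 1) := mul_pos hk0 (by linarith)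
    linarith
  have hN0 : 0 < N := by linarith
  set g : ℝ → ℝ := fun s => f s ^ k with hg
  have hgc : Continuous g := hf_cont.pow k
  have hgpos : ∀ t, 0 < g t := fun t => pow_pos (hf_pos t) k
  have hgmono : Monotone g := fun s t hst => pow_le_pow_left₀ (hf_pos s).le (hf_mono hst) k
  obtain ⟨m, y, hy, hmy, hm⟩ := exists_sphere_one_lt_sphere_two (hk.trans hkn) hk hp hu
  have he : 0 < 1 / N := by positivity
  obtain ⟨B, hB0, hB⟩ := exists_bound_integral_rpow hgc hgpos he ha hfin m
  have hint : ∀ a b, IntervalIntegrable g volume a b := fun a b => hgc.intervalIntegrable a b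
  have hHc : Continuous fun t => ∫ τ in m..t, g τ := intervalIntegral.continuous_primitive hint m
  -- The `max` acts only below `m`. It keeps `Q ≥ 1`, so that `T` is differentiable and strictly
  -- increasing on the whole line.
  set Q : ℝ → ℝ := fun t => 1 + max (∫ τ in m..t, g τ) 0 with hQ
  have hQpos : ∀ t, 0 < Q t := fun t => add_pos_of_pos_of_nonneg one_pos (le_max_right _ _)
  have hQc : Continuous Q := continuous_const.add (hHc.max continuous_const)
  set J : ℝ → ℝ := fun t => Q t ^ (-(1 / N)) with hJ
  have hJc : Continuous J := hQc.rpow_const fun t => Or.inl (hQpos t).ne'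
  have hJpos : ∀ t, 0 < J t := fun t => Real.rpow_pos_of_pos (hQpos t) _
  set T : ℝ → ℝ := fun s => ∫ t in m..s, J t with hT
  have hTd : ∀ s, HasDerivAt T (J s) s := fun s =>
    intervalIntegral.integral_hasDerivAt_right (hJc.intervalIntegrable _ _)
      (hJc.stronglyMeasurableAtFilter _ _) hJc.continuousAt
  have hTmono : StrictMono T := strictMono_of_hasDerivAt_pos hTd hJpos
  have hTm : T m = 0 := intervalIntegral.integral_same
  have hTB : ∀ s, T s ≤ B := by
    intro s
    rcases le_total m s with h | h
    · exact hB s h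
    · exact (hTmono.monotone h).trans (by rw [hTm]; exact hB0.le)
  set C := 1 / g m + B with hC
  set D : ℝ := 2 ^ n * (n : ℝ) ^ k with hD
  have hT1 : 0 < T (u y) := hTm ▸ hTmono hmy
  -- `δ < T (u y)` makes `Φ y > -δ`, the bound for `Φ` on the unit sphere. The last condition,
  -- possible since `N - 1 > 0`, makes the final chain of inequalities read `X < X`.
  obtain ⟨δ, hδ0, hδT, hδD⟩ : ∃ δ : ℝ, 0 < δ ∧ δ < T (u y) ∧
      D * ((p - 1) / N * δ ^ N + C * δ ^ (N - 1)) < 1 := by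
    have h1 : ContinuousAt (fun δ : ℝ => D * ((p - 1) / N * δ ^ N + C * δ ^ (N - 1))) 0 := by
      have e1 := Real.continuousAt_rpow_const 0 N (Or.inr hN0.le)
      have e2 := Real.continuousAt_rpow_const 0 (N - 1) (Or.inr (by linarith))
      exact continuousAt_const.mul ((continuousAt_const.mul e1).add (continuousAt_const.mul e2))
    have h2 : D * ((p - 1) / N * (0 : ℝ) ^ N + C * (0 : ℝ) ^ (N - 1)) < 1 := by
      rw [Real.zero_rpow hN0.ne', Real.zero_rpow (by linarith)]; simp
    have h3 := (h1.eventually (gt_mem_nhds h2)).filter_mono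
      (nhdsWithin_le_nhds (s := Set.Ioi (0 : ℝ)))
    obtain ⟨δ, hδ, hδ'⟩ := (h3.and (Ioo_mem_nhdsGT hT1)).exists
    exact ⟨δ, hδ'.1, hδ'.2, hδ⟩
  have hdiff : Differentiable ℝ u := hu.contDiff_one.differentiable (by norm_num)
  have hTc : Continuous T := continuous_iff_continuousAt.2 fun s => (hTd s).continuousAt
  set Φ : EuclideanSpace ℝ (Fin n) → ℝ := fun x => T (u x) - δ * ‖x‖ with hΦ
  have hΦc : Continuous Φ :=
    (hTc.comp hdiff.continuous).sub (continuous_const.mul continuous_norm)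
  have hΦy : -δ < Φ y := by
    simp only [hΦ, hy]; linarith
  -- Chosen so that `B - δ R = -3δ`: on the outer sphere `Φ` is below its value at `y`.
  set R : ℝ := 2 + (B + δ) / δ with hR
  have hR2 : 2 < R := by
    have : 0 < (B + δ) / δ := by positivity
    linarith
  have hRB : B - δ * R < -δ := by
    have : δ * R = 2 * δ + (B + δ) := by rw [hR]; field_simp
    linarith
  set K : Set (EuclideanSpace ℝ (Fin n)) := {x | 1 ≤ ‖x‖} ∩ Metric.closedBall 0 R with hK
  have hKc : IsCompact K :=
    (isCompact_closedBall _ _).inter_left (isClosed_le continuous_const continuous_norm)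
  have hyK : y ∈ K := ⟨by simp [hy], by rw [mem_closedBall_zero_iff, hy]; exact hR2.le⟩
  obtain ⟨z, hzK, hzmax⟩ := hKc.exists_isMaxOn ⟨y, hyK⟩ hΦc.continuousOn
  have hΦz : -δ < Φ z := hΦy.trans_le (hzmax hyK)
  have hz1 : 1 < ‖z‖ := by
    refine lt_of_le_of_ne hzK.1 fun h => ?_
    have h1 : T (u z) ≤ 0 := hTm ▸ hTmono.monotone (hm z h.symm)
    simp only [hΦ, ← h] at hΦz
    linarith
  have hzR : ‖z‖ < R := by
    refine lt_of_le_of_ne (mem_closedBall_zero_iff.1 hzK.2) fun h => ?_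
    have h1 := hTB (u z)
    simp only [hΦ, h] at hΦz
    linarith
  -- Above `m` the `max` in `Q` is inactive, so `Q` is differentiable at `u z` with derivative `g (u
  -- z)`.
  have hzm : m < u z := by
    have h1 : 0 < T (u z) := by
      simp only [hΦ] at hΦz
      nlinarith
    by_contra! h
    have := hTmono.monotone h
    linarith
  have hKz : K ∈ 𝓝 z := by
    refine inter_mem (mem_of_superset ((isOpen_lt continuous_const continuous_norm).mem_nhds hz1)
      fun x (hx : 1 < ‖x‖) => hx.le) ?_
    exact mem_of_superset (Metric.isOpen_ball.mem_nhds (mem_ball_zero_iff.2 hzR))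
      Metric.ball_subset_closedBall
  have hz0 : z ≠ 0 := by
    rintro rfl
    simp at hz1
    linarith
  have hzn : 0 < ‖z‖ := by linarith
  have hcd : ContDiffAt ℝ 2 u z := hu.contDiffOn_two.contDiffAt (isOpen_compl_singleton.mem_nhds hz0)
  have hQd : HasDerivAt Q (g (u z)) (u z) := by
    have h1 : HasDerivAt (fun t => 1 + ∫ τ in m..t, g τ) (g (u z)) (u z) :=
      (intervalIntegral.integral_hasDerivAt_right (hint _ _)
        (hgc.stronglyMeasurableAtFilter _ _) hgc.continuousAt).const_add 1
    refine h1.congr_of_eventuallyEq ?_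
    filter_upwards [lt_mem_nhds hzm] with t ht
    simp only [hQ]
    rw [max_eq_left (intervalIntegral.integral_nonneg ht.le fun τ _ => (hgpos τ).le)]
  have hJd : HasDerivAt J (g (u z) * (-(1 / N)) * Q (u z) ^ (-(1 / N) - 1)) (u z) :=
    hQd.rpow_const (Or.inl (hQpos _).ne')
  obtain ⟨hgrad, hhess⟩ := gradient_and_hessian_of_isLocalMax_sub_norm hdiff hcd hz0
    (Eventually.of_forall hTd) hJd (hJpos _) (hzmax.isLocalMax hKz)
  set q := Q (u z) with hq
  have hq0 : 0 < q := hQpos _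
  set ψ := δ / J (u z) with hψ
  have hψe : ψ = δ * q ^ (1 / N) := by
    simp only [hψ, hJ, ← hq]
    rw [Real.rpow_neg hq0.le, div_inv_eq_mul]
  have hψ0 : 0 < ψ := div_pos hδ0 (hJpos _)
  have hA : -(g (u z) * (-(1 / N)) * q ^ (-(1 / N) - 1) / J (u z)) * ψ ^ 2 =
      1 / N * (g (u z) / q) * ψ ^ 2 := by
    have : q ^ (-(1 / N) - 1) / J (u z) = 1 / q := by
      simp only [hJ, ← hq]
      rw [Real.rpow_sub hq0, Real.rpow_one]
      have := (Real.rpow_pos_of_pos hq0 (-(1 / N))).ne'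
      field_simp
    rw [mul_div_assoc, this]
    ring
  rw [hA] at hhess
  obtain ⟨-, -, l, hl, hlΓ, hsub⟩ := hu.subsolution z hz0
  have hνn : ‖‖z‖⁻¹ • z‖ = 1 := by
    rw [norm_smul, norm_inv, norm_norm, inv_mul_cancel₀ hzn.ne']
  obtain ⟨l', hl', hmax, hpair⟩ := exists_symPoly_eq_of_hessian_le hp hcd hνn hψ0.ne' hgrad hhess hl
  rw [abs_of_pos hψ0] at hmax hpair
  set b := ψ ^ (p - 2) * (ψ / ‖z‖) with hb
  have hb0 : 0 < b := by positivity
  set A := ψ ^ (p - 2) * (p - 1) * (1 / N * (g (u z) / q) * ψ ^ 2) with hAdef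
  have hA0 : 0 ≤ A := by
    have := hgpos (u z)
    have : 0 ≤ p - 1 := by linarith
    positivity
  have hlΓ' : l' ∈ gardingCone n k := fun i h1 h2 => by rw [hl']; exact hlΓ i h1 h2
  have h1 := symPoly_le_of_mem_gardingCone hk hlΓ' hb0 (show b ≤ A + b by linarith)
    (fun i => (hmax i).trans (max_le (by linarith) (by linarith))) hpair
  rw [hl'] at h1
  have h2 := radial_barrier_estimate hk hp hα hN hN1 hz1.le hq0 hδ0 (hgpos (u z)) hψe
    (rpow_one_sub_le_mul_of_bound hgc hgmono hgpos he hzm.le (hB _ hzm.le))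
  rw [← hb, ← hAdef, ← hC] at h2
  have hS : 0 < symPoly k l := hlΓ k hk le_rfl
  have hgn : ‖∇ u z‖ = ψ := by rw [hgrad, norm_smul, hνn, mul_one, Real.norm_of_nonneg hψ0.le]
  rw [hgn] at hsub
  have h3 : (‖z‖ ^ α * ψ ^ β) ^ k * g (u z) ≤ symPoly k l := by
    have hfz := hf_pos (u z)
    have := pow_le_pow_left₀ (by positivity) hsub k
    rwa [mul_pow, one_div, Real.rpow_inv_natCast_pow hS.le (by omega)] at this
  set X := (‖z‖ ^ α * ψ ^ β) ^ k * g (u z) with hX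
  have hX0 : 0 < X := by
    have := hgpos (u z)
    positivity
  have h4 : X ≤ D * (X * ((p - 1) / N * δ ^ N + C * δ ^ (N - 1))) := by
    calc X ≤ _ := h3
      _ ≤ _ := h1
      _ = D * ((A + b) * b ^ (k - 1)) := by rw [hD]; ring
      _ ≤ _ := by gcongr
  nlinarith

/-! ### Profiles with power behaviour at the origin. -/

/-- `w` is positive and `C¹` on `(0, ∞)` with derivative `w'`, behaves like a positive multiple of
`r ^ a` at the origin, and its logarithmic derivative behaves like that of `r ^ a`. -/
structure IsPowerLike (a : ℝ) (w w' : ℝ → ℝ) : Prop where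
  pos : ∀ r, 0 < r → 0 < w r
  hasDerivAt : ∀ r, 0 < r → HasDerivAt w (w' r) r
  continuousOn : ContinuousOn w' (Set.Ioi 0)
  tendsto : ∃ L, 0 < L ∧ Tendsto (fun r => w r / r ^ a) (𝓝[>] 0) (𝓝 L)
  tendsto_log : Tendsto (fun r => r * w' r / w r) (𝓝[>] 0) (𝓝 a)

namespace IsPowerLike

variable {a b : ℝ} {w w' z z' : ℝ → ℝ}

theorem continuousOn_self (h : IsPowerLike a w w') : ContinuousOn w (Set.Ioi 0) :=
  fun r hr => (h.hasDerivAt r hr).continuousAt.continuousWithinAt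

theorem rpow_id (a : ℝ) : IsPowerLike a (fun r => r ^ a) (fun r => a * r ^ (a - 1)) where
  pos r hr := Real.rpow_pos_of_pos hr a
  hasDerivAt r hr := Real.hasDerivAt_rpow_const (Or.inl hr.ne')
  continuousOn := continuousOn_const.mul
    (continuousOn_id.rpow_const fun r hr => Or.inl (ne_of_gt hr))
  tendsto := by
    refine ⟨1, one_pos, tendsto_const_nhds.congr' ?_⟩
    filter_upwards [self_mem_nhdsWithin] with r hr
    rw [div_self (Real.rpow_pos_of_pos hr a).ne']
  tendsto_log := by
    refine tendsto_const_nhds.congr' ?_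
    filter_upwards [self_mem_nhdsWithin] with r hr
    have hr0 : (0 : ℝ) < r := hr
    have := (Real.rpow_pos_of_pos hr0 a).ne'
    rw [Real.rpow_sub hr0, Real.rpow_one]
    field_simp

theorem const {c : ℝ} (hc : 0 < c) : IsPowerLike 0 (fun _ => c) (fun _ => 0) where
  pos _ _ := hc
  hasDerivAt r _ := hasDerivAt_const r c
  continuousOn := continuousOn_const
  tendsto := ⟨c, hc, by simp⟩
  tendsto_log := by simp

theorem mul (h : IsPowerLike a w w') (k : IsPowerLike b z z') :
    IsPowerLike (a + b) (fun r => w r * z r) (fun r => w' r * z r + w r * z' r) where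
  pos r hr := mul_pos (h.pos r hr) (k.pos r hr)
  hasDerivAt r hr := (h.hasDerivAt r hr).mul (k.hasDerivAt r hr)
  continuousOn := (h.continuousOn.mul k.continuousOn_self).add
    (h.continuousOn_self.mul k.continuousOn)
  tendsto := by
    obtain ⟨L, hL, hLt⟩ := h.tendsto
    obtain ⟨M, hM, hMt⟩ := k.tendsto
    refine ⟨L * M, mul_pos hL hM, (hLt.mul hMt).congr' ?_⟩
    filter_upwards [self_mem_nhdsWithin] with r hr
    rw [Real.rpow_add hr, div_mul_div_comm]
  tendsto_log := by
    refine (h.tendsto_log.add k.tendsto_log).congr' ?_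
    filter_upwards [self_mem_nhdsWithin] with r hr
    have h1 := (h.pos r hr).ne'
    have h2 := (k.pos r hr).ne'
    field_simp

theorem rpow (h : IsPowerLike a w w') (c : ℝ) :
    IsPowerLike (a * c) (fun r => w r ^ c) (fun r => w' r * c * w r ^ (c - 1)) where
  pos r hr := Real.rpow_pos_of_pos (h.pos r hr) c
  hasDerivAt r hr := (h.hasDerivAt r hr).rpow_const (Or.inl (h.pos r hr).ne')
  continuousOn := (h.continuousOn.mul continuousOn_const).mul
    (h.continuousOn_self.rpow_const fun r hr => Or.inl (h.pos r hr).ne')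
  tendsto := by
    obtain ⟨L, hL, hLt⟩ := h.tendsto
    refine ⟨L ^ c, Real.rpow_pos_of_pos hL c, (hLt.rpow_const (Or.inl hL.ne')).congr' ?_⟩
    filter_upwards [self_mem_nhdsWithin] with r hr
    have hr0 : (0 : ℝ) < r := hr
    rw [Real.div_rpow (h.pos r hr).le (Real.rpow_nonneg hr0.le _), Real.rpow_mul hr0.le]
  tendsto_log := by
    refine (h.tendsto_log.mul_const c).congr' ?_
    filter_upwards [self_mem_nhdsWithin] with r hr
    have h1 := h.pos r hr
    have h2 := (Real.rpow_pos_of_pos h1 c).ne'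
    rw [Real.rpow_sub h1, Real.rpow_one]
    field_simp

theorem comp_mul_rpow (h : IsPowerLike a w w') {c κ : ℝ} (hc : 0 < c) (hκ : 0 < κ) :
    IsPowerLike (κ * a) (fun r => w (c * r ^ κ))
      (fun r => w' (c * r ^ κ) * (c * (κ * r ^ (κ - 1)))) := by
  have hpos : ∀ r : ℝ, 0 < r → 0 < c * r ^ κ := fun r hr =>
    mul_pos hc (Real.rpow_pos_of_pos hr κ)
  have hcont : ContinuousOn (fun r : ℝ => c * r ^ κ) (Set.Ioi 0) :=
    continuousOn_const.mul (continuousOn_id.rpow_const fun r hr => Or.inl (ne_of_gt hr))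
  have hlim : Tendsto (fun r : ℝ => c * r ^ κ) (𝓝[>] 0) (𝓝[>] 0) := by
    refine tendsto_nhdsWithin_iff.2 ⟨?_, ?_⟩
    · have h1 := (Real.continuousAt_rpow_const 0 κ (Or.inr hκ.le)).tendsto.const_mul c
      rw [Real.zero_rpow hκ.ne', mul_zero] at h1
      exact h1.mono_left nhdsWithin_le_nhds
    · filter_upwards [self_mem_nhdsWithin] with r hr using hpos r hr
  refine ⟨fun r hr => h.pos _ (hpos r hr), fun r hr => ?_, ?_, ?_, ?_⟩
  · exact (h.hasDerivAt _ (hpos r hr)).comp r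
      ((Real.hasDerivAt_rpow_const (Or.inl hr.ne')).const_mul c)
  · exact (h.continuousOn.comp hcont fun r hr => hpos r hr).mul (continuousOn_const.mul
      (continuousOn_const.mul (continuousOn_id.rpow_const fun r hr => Or.inl (ne_of_gt hr))))
  · obtain ⟨L, hL, hLt⟩ := h.tendsto
    refine ⟨L * c ^ a, by positivity, ((hLt.comp hlim).mul_const (c ^ a)).congr' ?_⟩
    filter_upwards [self_mem_nhdsWithin] with r hr
    have hr0 : (0 : ℝ) < r := hr
    simp only [Function.comp]
    rw [Real.mul_rpow hc.le (by positivity), ← Real.rpow_mul hr0.le]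
    have := (Real.rpow_pos_of_pos hc a).ne'
    field_simp
  · refine ((h.tendsto_log.comp hlim).const_mul κ).congr' ?_
    filter_upwards [self_mem_nhdsWithin] with r hr
    have hr0 : (0 : ℝ) < r := hr
    simp only [Function.comp]
    rw [Real.rpow_sub hr0, Real.rpow_one]
    field_simp

end IsPowerLike

/-! ### The ordinary differential inequality for the radial profile. -/

/-- The inverse of `s ↦ ∫_0^s (∫_0^τ g)^{-1/N} dτ` is a global solution of `V'^N = ∫_0^V g`. -/
theorem exists_global_solution {g : ℝ → ℝ} (hg : Continuous g) (hmono : Monotone g)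
    (hpos : ∀ t, 0 < g t) {N : ℝ} (hN : 1 < N)
    (hinf : ∫⁻ t in Set.Ioi (1 : ℝ), ENNReal.ofReal ((∫ s in (0 : ℝ)..t, g s) ^ (-(1 / N))) = ⊤) :
    ∃ V : ℝ → ℝ, Continuous V ∧ V 0 = 0 ∧ (∀ ρ, 0 < ρ → 0 < V ρ) ∧
      ∀ ρ, 0 < ρ → HasDerivAt V ((∫ s in (0 : ℝ)..V ρ, g s) ^ (1 / N)) ρ := by
  have hN0 : 0 < N := by linarith
  have hint : ∀ a b, IntervalIntegrable g volume a b := fun a b => hg.intervalIntegrable a b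
  set G : ℝ → ℝ := fun t => ∫ s in (0 : ℝ)..t, g s with hG
  have hGc : Continuous G := intervalIntegral.continuous_primitive hint 0
  have hGpos : ∀ t, 0 < t → 0 < G t := fun t ht => intervalIntegral_pos_of_pos hg hpos ht
  have hGlow : ∀ t, 0 < t → g 0 * t ≤ G t := by
    intro t ht
    have : ∫ s in (0 : ℝ)..t, g 0 ≤ G t :=
      intervalIntegral.integral_mono_on ht.le intervalIntegrable_const (hint 0 t)
        fun s hs => hmono hs.1
    simpa [mul_comm] using this
  -- The value 1 for `t ≤ 0` makes the primitive `K` the identity there, hence a bijection of the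
  -- line. At `0+`, `J t ≤ (g 0 * t)^{-1/N}`, which is integrable since `N > 1`.
  set J : ℝ → ℝ := fun t => if 0 < t then G t ^ (-(1 / N)) else 1 with hJ
  have hJpos : ∀ t, 0 < J t := by
    intro t
    simp only [hJ]
    split_ifs with h
    · exact Real.rpow_pos_of_pos (hGpos t h) _
    · exact one_pos
  have hJm : Measurable J :=
    Measurable.ite measurableSet_Ioi (hGc.measurable.pow_const _) measurable_const
  have hJ0 : ∀ t, IntervalIntegrable J volume 0 t := by
    intro t
    rcases le_total t 0 with ht | ht
    · refine (intervalIntegrable_const (c := (1 : ℝ))).congr ?_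
      intro s hs
      rw [Set.uIoc_comm, Set.uIoc_of_le ht] at hs
      simp [hJ, not_lt.2 hs.2]
    · have h1 : IntervalIntegrable (fun s : ℝ => g 0 ^ (-(1 / N)) * s ^ (-(1 / N))) volume 0 t := by
        refine (intervalIntegral.intervalIntegrable_rpow' ?_).const_mul _
        have : 1 / N < 1 := by rw [div_lt_one hN0]; exact hN
        linarith
      refine h1.mono_fun' hJm.aestronglyMeasurable ?_
      filter_upwards [ae_restrict_mem measurableSet_uIoc] with s hs
      rw [Set.uIoc_of_le ht] at hs
      have hs0 : 0 < s := hs.1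
      rw [Real.norm_of_nonneg (hJpos s).le, ← Real.mul_rpow (hpos 0).le hs0.le]
      simp only [hJ, if_pos hs0]
      exact Real.rpow_le_rpow_of_nonpos (mul_pos (hpos 0) hs0) (hGlow s hs0)
        (by rw [neg_nonpos]; positivity)
  have hJint : ∀ a b, IntervalIntegrable J volume a b := fun a b => (hJ0 a).symm.trans (hJ0 b)
  set K : ℝ → ℝ := fun s => ∫ t in (0 : ℝ)..s, J t with hK
  have hKc : Continuous K := intervalIntegral.continuous_primitive hJint 0
  have hKmono : StrictMono K := by
    intro s t hst
    have h1 := intervalIntegral.intervalIntegral_pos_of_pos (hJint s t) hJpos hst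
    have h2 := intervalIntegral.integral_add_adjacent_intervals (hJint 0 s) (hJint s t)
    simp only [hK]
    linarith
  -- Divergence of the integral is what lets the inverse of `K` exist for all times.
  have hKtop : Tendsto K atTop atTop := by
    refine tendsto_atTop_atTop_of_monotone hKmono.monotone ?_
    by_contra! hcon
    obtain ⟨b, hb⟩ := hcon
    have h1 : IntegrableOn J (Set.Ioi 1) := by
      refine integrableOn_Ioi_of_intervalIntegral_norm_bounded (b - K 1) 1 (b := id)
        (l := atTop) (fun t => (hJint 1 t).1) tendsto_id ?_
      filter_upwards with t
      have h2 := intervalIntegral.integral_add_adjacent_intervals (hJint 0 1) (hJint 1 t)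
      have h3 := hb t
      simp only [Real.norm_of_nonneg (hJpos _).le, id]
      simp only [hK] at h3 ⊢
      linarith
    have h2 : ∫⁻ t in Set.Ioi (1 : ℝ), ENNReal.ofReal (J t) ≠ ⊤ :=
      (lintegral_ofReal_ne_top_iff_integrable hJm.aestronglyMeasurable
        (Eventually.of_forall fun t => (hJpos t).le)).2 h1
    apply h2
    rw [← hinf]
    refine setLIntegral_congr_fun measurableSet_Ioi fun t ht => ?_
    have ht0 : (0 : ℝ) < t := zero_lt_one.trans ht
    simp only [hJ, if_pos ht0]
    rfl
  have hKbot : Tendsto K atBot atBot := by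
    refine tendsto_id.congr' ?_
    filter_upwards [eventually_le_atBot 0] with s hs
    have : ∫ t in (0 : ℝ)..s, J t = ∫ t in (0 : ℝ)..s, (1 : ℝ) := by
      refine intervalIntegral.integral_congr_ae (Eventually.of_forall fun t ht => ?_)
      rw [Set.uIoc_comm, Set.uIoc_of_le hs] at ht
      simp [hJ, not_lt.2 ht.2]
    simp [hK, this]
  set e := (hKmono.orderIsoOfSurjective K (hKc.surjective hKtop hKbot)).symm with he
  have heK : ∀ ρ, K (e ρ) = ρ := fun ρ =>
    (hKmono.orderIsoOfSurjective K (hKc.surjective hKtop hKbot)).apply_symm_apply ρ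
  have hK0 : K 0 = 0 := intervalIntegral.integral_same
  have hVpos : ∀ ρ, 0 < ρ → 0 < e ρ := by
    intro ρ hρ
    rw [← hKmono.lt_iff_lt, hK0, heK]
    exact hρ
  refine ⟨e, e.toHomeomorph.continuous, ?_, hVpos, fun ρ hρ => ?_⟩
  · exact hKmono.injective (by rw [heK, hK0])
  · have hV := hVpos ρ hρ
    have hJat : ContinuousAt J (e ρ) := by
      have h1 : ContinuousAt (fun t => G t ^ (-(1 / N))) (e ρ) :=
        hGc.continuousAt.rpow_const (Or.inl (hGpos _ hV).ne')
      refine h1.congr ?_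
      filter_upwards [lt_mem_nhds hV] with t ht
      simp [hJ, ht]
    have hKd : HasDerivAt K (J (e ρ)) (e ρ) :=
      intervalIntegral.integral_hasDerivAt_right (hJint _ _)
        (hJm.stronglyMeasurable.stronglyMeasurableAtFilter) hJat
    have h2 := HasDerivAt.of_local_left_inverse (g := e) (a := ρ)
      e.toHomeomorph.continuous.continuousAt hKd (hJpos _).ne' (Eventually.of_forall heK)
    refine h2.congr_deriv ?_
    simp only [hJ, if_pos hV]
    rw [Real.rpow_neg (hGpos _ hV).le, inv_inv]

/-- The profile of a radial subsolution. -/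
theorem exists_radial_profile {g : ℝ → ℝ} (hg : Continuous g) (hmono : Monotone g)
    (hpos : ∀ t, 0 < g t) {N σ c : ℝ} (hN : 1 < N) (hσ : 0 ≤ σ) (hc : 0 < c)
    (hinf : ∫⁻ t in Set.Ioi (1 : ℝ), ENNReal.ofReal ((∫ s in (0 : ℝ)..t, g s) ^ (-(1 / N))) = ⊤) :
    ∃ v w w' : ℝ → ℝ, ContinuousOn v (Set.Ici 0) ∧ (∀ r, 0 < r → HasDerivAt v (w r) r) ∧
      IsPowerLike ((σ + 1) / (N - 1)) w w' ∧
      ∀ r, 0 < r → r ^ σ * g (v r) ≤ c * (w r ^ (N - 2) * w' r) := by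
  obtain ⟨V, hVc, hV0, hVpos, hVd⟩ := exists_global_solution hg hmono hpos hN hinf
  have hN0 : 0 < N := by linarith
  have hN1 : 0 < N - 1 := by linarith
  have hint : ∀ a b, IntervalIntegrable g volume a b := fun a b => hg.intervalIntegrable a b
  set G : ℝ → ℝ := fun t => ∫ s in (0 : ℝ)..t, g s with hG
  have hGc : Continuous G := intervalIntegral.continuous_primitive hint 0
  have hGd : ∀ t, HasDerivAt G (g t) t := fun t =>
    intervalIntegral.integral_hasDerivAt_right (hint _ _)
      (hg.stronglyMeasurableAtFilter _ _) hg.continuousAt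
  have hGpos : ∀ t, 0 < t → 0 < G t := fun t ht => intervalIntegral_pos_of_pos hg hpos ht
  have hGV : ∀ ρ, 0 < ρ → 0 < G (V ρ) := fun ρ hρ => hGpos _ (hVpos ρ hρ)
  -- With this exponent `W = V'^{N-1}`, and the equation for `V` becomes `W' = θ g(V)`, whose
  -- right-hand side is continuous up to the origin.
  set θ : ℝ := (N - 1) / N with hθ
  have hθ0 : 0 < θ := by positivity
  set W : ℝ → ℝ := fun ρ => G (V ρ) ^ θ with hW
  have hWc : Continuous W := (hGc.comp hVc).rpow_const fun _ => Or.inr hθ0.le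
  have hWd : ∀ ρ, 0 < ρ → HasDerivAt W (θ * g (V ρ)) ρ := by
    intro ρ hρ
    have h1 := (((hGd (V ρ)).comp ρ (hVd ρ hρ))).rpow_const (p := θ) (Or.inl (hGV ρ hρ).ne')
    refine h1.congr_deriv ?_
    have h2 : G (V ρ) ^ (1 / N) * G (V ρ) ^ (θ - 1) = 1 := by
      rw [← Real.rpow_add (hGV ρ hρ)]
      have : 1 / N + (θ - 1) = 0 := by rw [hθ]; field_simp; ring
      rw [this, Real.rpow_zero]
    calc _ = θ * g (V ρ) * (G (V ρ) ^ (1 / N) * G (V ρ) ^ (θ - 1)) := by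
          simp only [Function.comp]; ring
      _ = _ := by rw [h2, mul_one]
  have hW0 : W 0 = 0 := by
    simp only [hW, hV0, hG, intervalIntegral.integral_same]
    exact Real.zero_rpow hθ0.ne'
  have hL : 0 < θ * g 0 := mul_pos hθ0 (hpos 0)
  have hgV : Tendsto (fun ρ => θ * g (V ρ)) (𝓝[>] 0) (𝓝 (θ * g 0)) := by
    have : Continuous fun ρ => θ * g (V ρ) := continuous_const.mul (hg.comp hVc)
    have := this.tendsto 0
    rw [hV0] at this
    exact this.mono_left nhdsWithin_le_nhds
  have hWlim : Tendsto (fun ρ => W ρ / ρ) (𝓝[>] 0) (𝓝 (θ * g 0)) := by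
    have h1 : HasDerivWithinAt W (θ * g 0) (Set.Ici 0) 0 := by
      refine hasDerivWithinAt_Ici_of_tendsto_deriv (s := Set.Ioi 0)
        (fun ρ hρ => (hWd ρ hρ).differentiableAt.differentiableWithinAt)
        hWc.continuousWithinAt self_mem_nhdsWithin (hgV.congr' ?_)
      filter_upwards [self_mem_nhdsWithin] with ρ hρ using (hWd ρ hρ).deriv.symm
    rw [hasDerivWithinAt_iff_tendsto_slope] at h1
    have h2 : Set.Ici (0 : ℝ) \ {0} = Set.Ioi 0 := by
      ext r; simp [lt_iff_le_and_ne, eq_comm]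
    rw [h2] at h1
    refine h1.congr fun ρ => ?_
    rw [slope_def_field, hW0, sub_zero, sub_zero]
  have hWp : IsPowerLike 1 W (fun ρ => θ * g (V ρ)) := by
    refine ⟨fun ρ hρ => Real.rpow_pos_of_pos (hGV ρ hρ) _, hWd, ?_, ?_, ?_⟩
    · exact (continuous_const.mul (hg.comp hVc)).continuousOn
    · exact ⟨_, hL, by simpa using hWlim⟩
    · have h1 := hgV.div hWlim hL.ne'
      rw [div_self hL.ne'] at h1
      refine h1.congr' ?_
      filter_upwards [self_mem_nhdsWithin] with ρ hρ
      have hρ0 : (0 : ℝ) < ρ := hρ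
      have := (Real.rpow_pos_of_pos (hGV ρ hρ) θ).ne'
      simp only [Pi.div_apply, hW]
      field_simp
  -- In `v(r) = V(C r^κ)` the choice of `κ` gives `(κ - 1) N = σ`, which produces the weight `r^σ`,
  -- and `C` is fixed by `(C κ)^N = N / c`. The function `P` below is `v'^{N-1}`.
  set κ : ℝ := (N + σ) / N with hκ
  have hκ0 : 0 < κ := by positivity
  have hκ1 : κ - 1 = σ / N := by rw [hκ]; field_simp; ring
  set C : ℝ := (N / c) ^ (1 / N) / κ with hC
  have hC0 : 0 < C := by positivity
  have hCκ : (C * κ) ^ N = N / c := by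
    rw [hC, div_mul_cancel₀ _ hκ0.ne', ← Real.rpow_mul (by positivity), one_div_mul_cancel hN0.ne',
      Real.rpow_one]
  have hP := (hWp.comp_mul_rpow hC0 hκ0).mul ((IsPowerLike.const
    (show 0 < (C * κ) ^ (N - 1) by positivity)).mul (IsPowerLike.rpow_id ((κ - 1) * (N - 1))))
  set P : ℝ → ℝ := fun r => W (C * r ^ κ) * ((C * κ) ^ (N - 1) * r ^ ((κ - 1) * (N - 1))) with hPdef
  set P' : ℝ → ℝ := fun r => θ * g (V (C * r ^ κ)) * (C * (κ * r ^ (κ - 1))) *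
    ((C * κ) ^ (N - 1) * r ^ ((κ - 1) * (N - 1))) + W (C * r ^ κ) *
    (0 * r ^ ((κ - 1) * (N - 1)) + (C * κ) ^ (N - 1) *
      ((κ - 1) * (N - 1) * r ^ ((κ - 1) * (N - 1) - 1))) with hP'def
  have hexp : κ * 1 + (0 + (κ - 1) * (N - 1)) = σ + 1 := by
    rw [hκ]; field_simp; ring
  rw [hexp] at hP
  have hw := hP.rpow (1 / (N - 1))
  rw [mul_one_div] at hw
  refine ⟨fun r => V (C * r ^ κ), _, _, ?_, ?_, hw, ?_⟩
  · exact hVc.comp_continuousOn (continuousOn_const.mul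
      (continuousOn_id.rpow_const fun r _ => Or.inr hκ0.le))
  · intro r hr
    have hρ : 0 < C * r ^ κ := by positivity
    have h1 := (hVd _ hρ).comp r ((Real.hasDerivAt_rpow_const (p := κ) (Or.inl hr.ne')).const_mul C)
    refine h1.congr_deriv ?_
    have hGp := hGV _ hρ
    simp only [hPdef, hW]
    rw [Real.mul_rpow (by positivity) (by positivity), Real.mul_rpow (by positivity) (by positivity),
      ← Real.rpow_mul hGp.le, ← Real.rpow_mul (by positivity), ← Real.rpow_mul hr.le,
      mul_assoc (κ - 1), mul_one_div_cancel hN1.ne', Real.rpow_one, mul_one]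
    have : θ * (1 / (N - 1)) = 1 / N := by rw [hθ]; field_simp
    rw [this]
    simp only [hG]
    ring
  · intro r hr
    have hρ : 0 < C * r ^ κ := by positivity
    have hPr : 0 < P r := hP.pos r hr
    have h1 : (P r ^ (1 / (N - 1))) ^ (N - 2) *
        (P' r * (1 / (N - 1)) * P r ^ (1 / (N - 1) - 1)) = P' r / (N - 1) := by
      have e1 : (P r ^ (1 / (N - 1))) ^ (N - 2) * P r ^ (1 / (N - 1) - 1) = 1 := by
        rw [← Real.rpow_mul hPr.le, ← Real.rpow_add hPr]
        have : 1 / (N - 1) * (N - 2) + (1 / (N - 1) - 1) = 0 := by field_simp; ring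
        rw [this, Real.rpow_zero]
      calc _ = P' r / (N - 1) * ((P r ^ (1 / (N - 1))) ^ (N - 2) * P r ^ (1 / (N - 1) - 1)) := by
            ring
        _ = _ := by rw [e1, mul_one]
    rw [h1]
    have hWr : 0 < W (C * r ^ κ) := hWp.pos _ hρ
    -- The discarded summand of `P'` comes from differentiating the power of `r`; it is nonnegative
    -- because `σ ≥ 0`.
    have h2 : θ * g (V (C * r ^ κ)) * (C * (κ * r ^ (κ - 1))) *
        ((C * κ) ^ (N - 1) * r ^ ((κ - 1) * (N - 1))) ≤ P' r := by
      simp only [hP'def]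
      refine le_add_of_nonneg_right ?_
      have : 0 ≤ κ - 1 := by rw [hκ1]; positivity
      positivity
    have h3 : θ * g (V (C * r ^ κ)) * (C * (κ * r ^ (κ - 1))) *
        ((C * κ) ^ (N - 1) * r ^ ((κ - 1) * (N - 1))) =
        (N - 1) / c * (r ^ σ * g (V (C * r ^ κ))) := by
      have e1 : (C * κ) * (C * κ) ^ (N - 1) = N / c := by
        rw [← hCκ]
        nth_rewrite 1 [← Real.rpow_one (C * κ)]
        rw [← Real.rpow_add (by positivity)]
        congr 1; ring
      have e2 : r ^ (κ - 1) * r ^ ((κ - 1) * (N - 1)) = r ^ σ := by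
        rw [← Real.rpow_add hr]
        congr 1
        rw [hκ1]; field_simp; ring
      calc _ = θ * g (V (C * r ^ κ)) * ((C * κ) * (C * κ) ^ (N - 1)) *
            (r ^ (κ - 1) * r ^ ((κ - 1) * (N - 1))) := by ring
        _ = _ := by rw [e1, e2, hθ]; field_simp
    rw [h3] at h2
    rw [div_mul_eq_mul_div, div_le_iff₀ hc] at h2
    rw [mul_div_assoc', le_div_iff₀ hN1]
    linarith

/-- Write `r φ' = φ · (r φ'/φ)`, whose limit is `c a`. It vanishes in either case: `a = 0`, or `a >
0` and `c = 0`. The two limits are the hypotheses of `contDiff_one_radialField`. -/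
theorem IsPowerLike.exists_tendsto {a : ℝ} {φ φ' : ℝ → ℝ} (h : IsPowerLike a φ φ') (ha : 0 ≤ a) :
    ∃ c, Tendsto φ (𝓝[>] 0) (𝓝 c) ∧ Tendsto (fun r => r * φ' r) (𝓝[>] 0) (𝓝 0) ∧
      (0 < a → c = 0) := by
  obtain ⟨L, hL, hLt⟩ := h.tendsto
  have h1 : Tendsto (fun r : ℝ => r ^ a) (𝓝[>] 0) (𝓝 ((0 : ℝ) ^ a)) :=
    (Real.continuousAt_rpow_const 0 a (Or.inr ha)).tendsto.mono_left nhdsWithin_le_nhds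
  have h2 : Tendsto φ (𝓝[>] 0) (𝓝 (L * (0 : ℝ) ^ a)) := by
    refine (hLt.mul h1).congr' ?_
    filter_upwards [self_mem_nhdsWithin] with r hr
    rw [div_mul_cancel₀ _ (Real.rpow_pos_of_pos hr a).ne']
  refine ⟨_, h2, ?_, fun h => by rw [Real.zero_rpow h.ne', mul_zero]⟩
  have h3 : L * (0 : ℝ) ^ a * a = 0 := by
    rcases ha.eq_or_lt with h | h
    · rw [← h, mul_zero]
    · rw [Real.zero_rpow h.ne', mul_zero, zero_mul]
  have h4 := h2.mul h.tendsto_log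
  rw [h3] at h4
  refine h4.congr' ?_
  filter_upwards [self_mem_nhdsWithin] with r hr
  have := (h.pos r hr).ne'
  field_simp

/-! ### Calculus of radial fields and functions. -/

section

variable {n : ℕ}

theorem hasFDerivAt_norm_of_ne_zero {x : EuclideanSpace ℝ (Fin n)} (hx : x ≠ 0) :
    HasFDerivAt (fun y : EuclideanSpace ℝ (Fin n) => ‖y‖) (‖x‖⁻¹ • innerSL ℝ x) x := by
  have h1 := (hasStrictFDerivAt_norm_sq x).hasFDerivAt.sqrt (by simpa using hx)
  simp only [Real.sqrt_sq (norm_nonneg _)] at h1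
  refine h1.congr_fderiv ?_
  ext y
  simp only [_root_.smul_apply, smul_eq_mul, nsmul_eq_mul]
  push_cast
  have := norm_ne_zero_iff.2 hx
  field_simp

/-- The derivative of `x ↦ φ(|x|) x` off the origin. -/
noncomputable def radialFieldDeriv (φ φ' : ℝ → ℝ) (x : EuclideanSpace ℝ (Fin n)) :
    EuclideanSpace ℝ (Fin n) →L[ℝ] EuclideanSpace ℝ (Fin n) :=
  φ ‖x‖ • ContinuousLinearMap.id ℝ _ + ((φ' ‖x‖ * ‖x‖⁻¹) • innerSL ℝ x).smulRight x

theorem hasFDerivAt_radialField {φ φ' : ℝ → ℝ} (hφ : ∀ r, 0 < r → HasDerivAt φ (φ' r) r)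
    {x : EuclideanSpace ℝ (Fin n)} (hx : x ≠ 0) :
    HasFDerivAt (fun y => φ ‖y‖ • y) (radialFieldDeriv φ φ' x) x := by
  have h1 := (hφ ‖x‖ (norm_pos_iff.2 hx)).comp_hasFDerivAt x (hasFDerivAt_norm_of_ne_zero hx)
  have h2 := h1.smul (hasFDerivAt_id x)
  refine h2.congr_fderiv ?_
  simp only [radialFieldDeriv, id, smul_smul, Function.comp]

theorem continuousOn_radialFieldDeriv {φ φ' : ℝ → ℝ} (hφ : ∀ r, 0 < r → HasDerivAt φ (φ' r) r)
    (hφ' : ContinuousOn φ' (Set.Ioi 0)) :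
    ContinuousOn (radialFieldDeriv (n := n) φ φ') {0}ᶜ := by
  have hn : ContinuousOn (fun x : EuclideanSpace ℝ (Fin n) => ‖x‖) {0}ᶜ :=
    continuous_norm.continuousOn
  have hmaps : Set.MapsTo (fun x : EuclideanSpace ℝ (Fin n) => ‖x‖) {0}ᶜ (Set.Ioi 0) :=
    fun x hx => norm_pos_iff.2 hx
  have h1 : ContinuousOn (fun x : EuclideanSpace ℝ (Fin n) => φ ‖x‖) {0}ᶜ :=
    ContinuousOn.comp (fun r hr => (hφ r hr).continuousAt.continuousWithinAt) hn hmaps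
  have h2 : ContinuousOn (fun x : EuclideanSpace ℝ (Fin n) => φ' ‖x‖ * ‖x‖⁻¹) {0}ᶜ :=
    (hφ'.comp hn hmaps).mul (hn.inv₀ fun x hx => norm_ne_zero_iff.2 hx)
  refine (h1.smul continuousOn_const).add ?_
  have h3 : ContinuousOn (fun x : EuclideanSpace ℝ (Fin n) =>
      (φ' ‖x‖ * ‖x‖⁻¹) • innerSL ℝ x) {0}ᶜ := h2.smul (innerSL ℝ).continuous.continuousOn
  exact ((ContinuousLinearMap.smulRightL ℝ (EuclideanSpace ℝ (Fin n))
    (EuclideanSpace ℝ (Fin n))).continuous₂).comp_continuousOn (h3.prodMk continuousOn_id)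

theorem norm_radialFieldDeriv_sub_le {φ φ' : ℝ → ℝ} (c : ℝ) {x : EuclideanSpace ℝ (Fin n)} :
    ‖radialFieldDeriv φ φ' x - c • ContinuousLinearMap.id ℝ _‖ ≤
      |φ ‖x‖ - c| + |‖x‖ * φ' ‖x‖| := by
  have h0 : radialFieldDeriv φ φ' x - c • ContinuousLinearMap.id ℝ _ =
      (φ ‖x‖ - c) • ContinuousLinearMap.id ℝ (EuclideanSpace ℝ (Fin n)) +
        ((φ' ‖x‖ * ‖x‖⁻¹) • innerSL ℝ x).smulRight x := by
    ext1 y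
    simp only [radialFieldDeriv, _root_.sub_apply, _root_.add_apply, _root_.smul_apply,
      ContinuousLinearMap.id_apply, sub_smul]
    abel
  rw [h0]
  refine (norm_add_le _ _).trans (add_le_add ?_ ?_)
  · rw [norm_smul, Real.norm_eq_abs]
    exact mul_le_of_le_one_right (abs_nonneg _) ContinuousLinearMap.norm_id_le
  · rw [ContinuousLinearMap.norm_smulRight_apply, norm_smul, innerSL_apply_norm, norm_mul, norm_inv,
      norm_norm, abs_mul, abs_of_nonneg (norm_nonneg x), Real.norm_eq_abs]
    rcases eq_or_ne ‖x‖ 0 with h | h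
    · simp [h]
    · field_simp
      exact le_rfl

/-- Off the origin the derivative differs from `c • id` by at most `|φ - c| + |r φ'|` in norm, so it
extends continuously by `c • id`. The value `φ 0` plays no role, since it multiplies the zero
vector. -/
theorem contDiff_one_radialField {φ φ' : ℝ → ℝ} {c : ℝ} (hφ : ∀ r, 0 < r → HasDerivAt φ (φ' r) r)
    (hφ' : ContinuousOn φ' (Set.Ioi 0)) (hc : Tendsto φ (𝓝[>] 0) (𝓝 c))
    (hc' : Tendsto (fun r => r * φ' r) (𝓝[>] 0) (𝓝 0)) :
    ContDiff ℝ 1 (fun x : EuclideanSpace ℝ (Fin n) => φ ‖x‖ • x) := by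
  have hnorm : Tendsto (fun x : EuclideanSpace ℝ (Fin n) => ‖x‖) (𝓝[≠] 0) (𝓝[>] 0) :=
    tendsto_norm_nhdsNE_zero
  set D : EuclideanSpace ℝ (Fin n) → EuclideanSpace ℝ (Fin n) →L[ℝ] EuclideanSpace ℝ (Fin n) :=
    Function.update (radialFieldDeriv φ φ') 0 (c • ContinuousLinearMap.id ℝ _) with hD
  refine contDiff_one_iff_hasFDerivAt.2 ⟨D, ?_, fun x => ?_⟩
  · refine continuous_iff_continuousAt.2 fun x => ?_
    rcases eq_or_ne x 0 with rfl | hx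
    · rw [hD, continuousAt_update_same, tendsto_iff_norm_sub_tendsto_zero]
      have h1 : Tendsto (fun x : EuclideanSpace ℝ (Fin n) => |φ ‖x‖ - c| + |‖x‖ * φ' ‖x‖|)
          (𝓝[≠] 0) (𝓝 0) := by
        have h2 := ((hc.sub_const c).abs.add hc'.abs).comp hnorm
        simpa [Function.comp_def] using h2
      exact squeeze_zero (fun _ => norm_nonneg _) (fun _ => norm_radialFieldDeriv_sub_le c) h1
    · rw [hD, continuousAt_update_of_ne hx]
      exact (continuousOn_radialFieldDeriv hφ hφ').continuousAt (isOpen_compl_singleton.mem_nhds hx)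
  · rcases eq_or_ne x 0 with rfl | hx
    · rw [hD, Function.update_self, hasFDerivAt_iff_tendsto]
      simp only [norm_zero, smul_zero, sub_zero]
      have h1 : Tendsto (fun x : EuclideanSpace ℝ (Fin n) => |φ ‖x‖ - c|) (𝓝[≠] 0) (𝓝 0) := by
        have h2 := ((hc.sub_const c).abs).comp hnorm
        simpa [Function.comp_def] using h2
      have h3 : Tendsto (fun x : EuclideanSpace ℝ (Fin n) => ‖x‖⁻¹ * ‖φ ‖x‖ • x -
          (c • ContinuousLinearMap.id ℝ (EuclideanSpace ℝ (Fin n))) x‖) (𝓝[≠] 0) (𝓝 0) := by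
        refine h1.congr' ?_
        filter_upwards [self_mem_nhdsWithin] with y hy
        have hy0 : ‖y‖ ≠ 0 := norm_ne_zero_iff.2 hy
        rw [_root_.smul_apply, ContinuousLinearMap.id_apply, ← sub_smul, norm_smul,
          Real.norm_eq_abs]
        field_simp
      rw [← nhdsNE_sup_pure]
      refine h3.sup ?_
      rw [tendsto_pure_left]
      intro s hs
      simpa using mem_of_mem_nhds hs
    · rw [hD, Function.update_of_ne hx]
      exact hasFDerivAt_radialField hφ hx

theorem contDiffOn_one_radialField {φ φ' : ℝ → ℝ} (hφ : ∀ r, 0 < r → HasDerivAt φ (φ' r) r)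
    (hφ' : ContinuousOn φ' (Set.Ioi 0)) :
    ContDiffOn ℝ 1 (fun x : EuclideanSpace ℝ (Fin n) => φ ‖x‖ • x) {0}ᶜ := fun _ hx =>
  (contDiffAt_one_iff.2 ⟨_, _, isOpen_compl_singleton.mem_nhds hx,
    continuousOn_radialFieldDeriv hφ hφ', fun _ hy => hasFDerivAt_radialField hφ hy⟩
    ).contDiffWithinAt

theorem continuous_radialField {φ : ℝ → ℝ} (hφ : ContinuousOn φ (Set.Ioi 0))
    (h0 : Tendsto (fun r => r * φ r) (𝓝[>] 0) (𝓝 0)) :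
    Continuous (fun x : EuclideanSpace ℝ (Fin n) => φ ‖x‖ • x) := by
  refine continuous_iff_continuousAt.2 fun x => ?_
  rcases eq_or_ne x 0 with rfl | hx
  · rw [continuousAt_iff_punctured_nhds, smul_zero, tendsto_zero_iff_norm_tendsto_zero]
    have h1 : Tendsto (fun x : EuclideanSpace ℝ (Fin n) => |‖x‖ * φ ‖x‖|) (𝓝[≠] 0) (𝓝 0) := by
      have h2 := h0.abs.comp (tendsto_norm_nhdsNE_zero (E := EuclideanSpace ℝ (Fin n)))
      simpa [Function.comp_def] using h2
    refine h1.congr fun y => ?_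
    rw [norm_smul, abs_mul, abs_norm, mul_comm, Real.norm_eq_abs]
  · have h1 : ContinuousAt φ ‖x‖ := hφ.continuousAt (isOpen_Ioi.mem_nhds (norm_pos_iff.2 hx))
    exact (ContinuousAt.comp (g := φ) h1 continuous_norm.continuousAt).smul continuousAt_id

/-- At the origin the one-sided derivative of `v` is the limit of `w`, hence zero. The factor `‖x‖ ^
(-1 : ℝ)` is a real power so that the coefficient is a product of power-like functions. -/
theorem hasGradientAt_radial {v w : ℝ → ℝ} (hv : ContinuousOn v (Set.Ici 0))
    (hvd : ∀ r, 0 < r → HasDerivAt v (w r) r) (hw : Tendsto w (𝓝[>] 0) (𝓝 0))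
    (x : EuclideanSpace ℝ (Fin n)) :
    HasGradientAt (fun y : EuclideanSpace ℝ (Fin n) => v ‖y‖) ((w ‖x‖ * ‖x‖ ^ (-1 : ℝ)) • x) x := by
  rw [hasGradientAt_iff_hasFDerivAt]
  rcases eq_or_ne x 0 with rfl | hx
  · rw [smul_zero, map_zero]
    have h1 : HasDerivWithinAt v 0 (Set.Ici 0) 0 := by
      refine hasDerivWithinAt_Ici_of_tendsto_deriv (s := Set.Ioi 0)
        (fun ρ hρ => (hvd ρ hρ).differentiableAt.differentiableWithinAt)
        ((hv 0 Set.self_mem_Ici).mono Set.Ioi_subset_Ici_self) self_mem_nhdsWithin (hw.congr' ?_)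
      filter_upwards [self_mem_nhdsWithin] with ρ hρ using (hvd ρ hρ).deriv.symm
    have h2 : HasFDerivWithinAt v (0 : ℝ →L[ℝ] ℝ) (Set.Ici 0) 0 := by
      simpa using h1.hasFDerivWithinAt
    have h3 := hasFDerivWithinAt_iff_isLittleO.1 h2
    have h4 : Tendsto (fun y : EuclideanSpace ℝ (Fin n) => ‖y‖) (𝓝 0) (𝓝[Set.Ici 0] 0) := by
      refine tendsto_nhdsWithin_iff.2 ⟨?_, Eventually.of_forall fun y => norm_nonneg y⟩
      simpa using (continuous_norm (E := EuclideanSpace ℝ (Fin n))).tendsto 0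
    have h5 := h3.comp_tendsto h4
    rw [hasFDerivAt_iff_isLittleO]
    refine (h5.trans_isBigO (Asymptotics.isBigO_of_le _ fun y => ?_)).congr_left fun y => ?_
    · simp
    · simp
  · have hr := norm_pos_iff.2 hx
    have h1 := (hvd ‖x‖ hr).comp_hasFDerivAt x (hasFDerivAt_norm_of_ne_zero hx)
    refine h1.congr_fderiv ?_
    ext y
    simp [Real.rpow_neg_one, mul_assoc]

theorem contDiff_one_of_hasGradientAt {u : EuclideanSpace ℝ (Fin n) → ℝ}
    {F : EuclideanSpace ℝ (Fin n) → EuclideanSpace ℝ (Fin n)} (hF : ∀ x, HasGradientAt u (F x) x)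
    (hc : Continuous F) : ContDiff ℝ 1 u :=
  contDiff_one_iff_hasFDerivAt.2 ⟨fun x => InnerProductSpace.toDual ℝ _ (F x),
    (InnerProductSpace.toDual ℝ _).continuous.comp hc, fun x =>
      hasGradientAt_iff_hasFDerivAt.1 (hF x)⟩

theorem contDiffOn_two_of_hasGradientAt {u : EuclideanSpace ℝ (Fin n) → ℝ}
    {F : EuclideanSpace ℝ (Fin n) → EuclideanSpace ℝ (Fin n)} (hF : ∀ x, HasGradientAt u (F x) x)
    {s : Set (EuclideanSpace ℝ (Fin n))} (hs : IsOpen s) (hc : ContDiffOn ℝ 1 F s) :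
    ContDiffOn ℝ 2 u s := by
  rw [show (2 : WithTop ℕ∞) = 1 + 1 by norm_num, contDiffOn_succ_iff_fderiv_of_isOpen hs]
  refine ⟨fun x _ => (hF x).differentiableAt.differentiableWithinAt, by simp, ?_⟩
  have : fderiv ℝ u = fun x => innerSL ℝ (F x) := by
    funext x
    rw [(hasGradientAt_iff_hasFDerivAt.1 (hF x)).fderiv]
    rfl
  rw [this]
  exact (innerSL ℝ).contDiff.comp_contDiffOn hc

theorem pGradient_eq_radialField {p : ℝ} {u : EuclideanSpace ℝ (Fin n) → ℝ} {w : ℝ → ℝ}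
    (hpos : ∀ r, 0 < r → 0 < w r)
    (hF : ∀ x, HasGradientAt u ((w ‖x‖ * ‖x‖ ^ (-1 : ℝ)) • x) x) :
    pGradient p u = fun x => (w ‖x‖ ^ (p - 1) * ‖x‖ ^ (-1 : ℝ)) • x := by
  funext x
  rw [pGradient, (hF x).gradient]
  rcases eq_or_ne x 0 with rfl | hx
  · simp
  have hr := norm_pos_iff.2 hx
  have hw := hpos _ hr
  rw [norm_smul, Real.norm_of_nonneg (by positivity), smul_smul, Real.rpow_neg_one, mul_assoc,
    inv_mul_cancel₀ hr.ne', mul_one, ← mul_assoc]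
  congr 2
  nth_rewrite 2 [← Real.rpow_one (w ‖x‖)]
  rw [← Real.rpow_add hw]
  congr 1; ring

-- The matrix is a rank-one matrix shifted by a scalar, with eigenvalue `a + c|x|²` along `x` and
-- `a` on the complement. The position `i₀` given to the exceptional eigenvalue is arbitrary.
open Polynomial in
theorem isEigenvalueVector_smul_one_add_vecMulVec (a c : ℝ) (x : Fin n → ℝ) (i₀ : Fin n) :
    IsEigenvalueVector (a • (1 : Matrix (Fin n) (Fin n) ℝ) + c • Matrix.vecMulVec x x)
      (Function.update (fun _ => a) i₀ (a + c * (x ⬝ᵥ x))) := by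
  have h1 : a • (1 : Matrix (Fin n) (Fin n) ℝ) + c • Matrix.vecMulVec x x =
      Matrix.vecMulVec (c • x) x - Matrix.scalar (Fin n) (-a) := by
    rw [Matrix.smul_vecMulVec, Matrix.scalar_apply, ← Matrix.smul_one_eq_diagonal, neg_smul,
      sub_neg_eq_add, add_comm]
  have hn : 1 ≤ n := i₀.pos
  have h2 : ∏ i : Fin n, (X - C (Function.update (fun _ => a) i₀ (a + c * (x ⬝ᵥ x)) i)) =
      (X - C (a + c * (x ⬝ᵥ x))) * (X - C a) ^ (n - 1) := by
    rw [← Finset.mul_prod_erase _ _ (Finset.mem_univ i₀), Function.update_self]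
    congr 1
    rw [Finset.prod_congr rfl (g := fun _ => X - C a), Finset.prod_const,
      Finset.card_erase_of_mem (Finset.mem_univ i₀), Finset.card_univ, Fintype.card_fin]
    intro i hi
    rw [Function.update_of_ne (Finset.ne_of_mem_erase hi)]
  rw [IsEigenvalueVector, h1, Matrix.charpoly_sub_scalar, Matrix.charpoly_vecMulVec, h2,
    smul_dotProduct, Fintype.card_fin]
  obtain ⟨m, rfl⟩ : ∃ m, n = m + 1 := ⟨n - 1, by omega⟩
  simp only [Nat.add_sub_cancel, smul_eq_mul, sub_comp, mul_comp, pow_comp, X_comp, C_comp, map_neg,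
    map_add, map_mul, smul_eq_C_mul]
  ring

theorem symPoly_pos {k : ℕ} (hkn : k ≤ n) {l : Fin n → ℝ} (hl : ∀ i, 0 < l i) :
    0 < symPoly k l := by
  refine Finset.sum_pos (fun s _ => Finset.prod_pos fun i _ => hl i) ?_
  rw [Finset.powersetCard_nonempty]
  simpa using hkn

/-- All the products are positive, so one of them, over a set containing `i₀`, is a lower bound. -/
theorem mul_pow_le_symPoly_update {k : ℕ} (hk : 1 ≤ k) (hkn : k ≤ n) {a b : ℝ} (ha : 0 < a)
    (hb : 0 < b) (i₀ : Fin n) :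
    b * a ^ (k - 1) ≤ symPoly k (Function.update (fun _ => a) i₀ b) := by
  have hpos : ∀ i, 0 < Function.update (fun _ : Fin n => a) i₀ b i := by
    intro i
    rcases eq_or_ne i i₀ with rfl | h
    · rwa [Function.update_self]
    · rwa [Function.update_of_ne h]
  obtain ⟨s, hs, hsu, hsc⟩ := Finset.exists_subsuperset_card_eq
    (Finset.subset_univ ({i₀} : Finset (Fin n))) (n := k) (by simpa using hk) (by simpa using hkn)
  have hi₀ : i₀ ∈ s := hs (Finset.mem_singleton_self i₀)
  have h1 : ∏ i ∈ s, Function.update (fun _ : Fin n => a) i₀ b i = b * a ^ (k - 1) := by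
    rw [← Finset.mul_prod_erase _ _ hi₀, Function.update_self,
      Finset.prod_congr rfl (g := fun _ => a), Finset.prod_const,
      Finset.card_erase_of_mem hi₀, hsc]
    intro i hi
    rw [Function.update_of_ne (Finset.ne_of_mem_erase hi)]
  rw [← h1]
  exact Finset.single_le_sum (f := fun s => ∏ i ∈ s, Function.update (fun _ : Fin n => a) i₀ b i)
    (fun s _ => (Finset.prod_pos fun i _ => hpos i).le) (Finset.mem_powersetCard.2 ⟨hsu, hsc⟩)

end

/-! ### Radial subsolutions. -/

section

variable {n : ℕ}

theorem pHessian_of_radialField {p : ℝ} {u : EuclideanSpace ℝ (Fin n) → ℝ} {φ φ' : ℝ → ℝ}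
    (hφ : ∀ r, 0 < r → HasDerivAt φ (φ' r) r) (hpG : pGradient p u = fun x => φ ‖x‖ • x)
    {x : EuclideanSpace ℝ (Fin n)} (hx : x ≠ 0) :
    pHessian p u x = φ ‖x‖ • (1 : Matrix (Fin n) (Fin n) ℝ) +
      (φ' ‖x‖ * ‖x‖⁻¹) • Matrix.vecMulVec x x := by
  ext i j
  rw [pHessian, Matrix.of_apply, hpG, (hasFDerivAt_radialField hφ hx).fderiv, radialFieldDeriv]
  simp only [_root_.add_apply, _root_.smul_apply, ContinuousLinearMap.id_apply, PiLp.add_apply,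
    PiLp.smul_apply, ContinuousLinearMap.smulRight_apply, innerSL_apply_apply, smul_eq_mul,
    Matrix.add_apply, Matrix.smul_apply, Matrix.one_apply, Matrix.vecMulVec_apply,
    EuclideanSpace.inner_single_right, PiLp.single_apply]
  congr 1
  · simp only [eq_comm]
  · simp; ring

/-- With `a = w^{p-1}/r` and `b = (w^{p-1})'` the eigenvalues are `b` once and `a` otherwise, and
`S_k ≥ b a^{k-1}`. Multiplied by `w^{kβ} r^{-(k-1)}`, the hypothesis `hineq` says exactly that `b
a^{k-1}` dominates the k-th power of the right-hand side. It also forces `w' > 0`, so all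
eigenvalues are positive. -/
theorem isEntireAdmissibleSubsolution_radial {k : ℕ} (hk : 1 ≤ k) (hkn : k ≤ n) {p α β e : ℝ}
    {f : ℝ → ℝ} (hf_pos : ∀ t, 0 < f t) (hp : 1 < p) (he : 0 < e)
    {v w w' : ℝ → ℝ} (hv : ContinuousOn v (Set.Ici 0))
    (hvd : ∀ r, 0 < r → HasDerivAt v (w r) r) (hw : IsPowerLike e w w')
    (hineq : ∀ r, 0 < r → r ^ ((k : ℝ) * α + k - 1) * f (v r) ^ k ≤
      (p - 1) * (w r ^ ((k : ℝ) * (p - β - 1) + 1 - 2) * w' r)) :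
    IsEntireAdmissibleSubsolution k p α β f (fun x : EuclideanSpace ℝ (Fin n) => v ‖x‖) := by
  have i₀ : Fin n := ⟨0, hk.trans hkn⟩
  set u : EuclideanSpace ℝ (Fin n) → ℝ := fun x => v ‖x‖ with hu
  obtain ⟨c, hwc, -, hc0⟩ := hw.exists_tendsto he.le
  rw [hc0 he] at hwc
  have hF := hasGradientAt_radial (n := n) hv hvd hwc
  have hφ₁ := hw.mul (IsPowerLike.rpow_id (-1))
  have hφ := (hw.rpow (p - 1)).mul (IsPowerLike.rpow_id (-1))
  have hpG := pGradient_eq_radialField (p := p) hw.pos hF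
  refine ⟨contDiff_one_of_hasGradientAt hF (continuous_radialField hφ₁.continuousOn_self ?_),
    contDiffOn_two_of_hasGradientAt hF isOpen_compl_singleton
      (contDiffOn_one_radialField hφ₁.hasDerivAt hφ₁.continuousOn), ?_, ?_⟩
  · refine hwc.congr' ?_
    filter_upwards [self_mem_nhdsWithin] with r hr
    have : r ≠ 0 := ne_of_gt hr
    rw [Real.rpow_neg_one]
    field_simp
  · refine ⟨0, EuclideanSpace.single i₀ 1, ?_⟩
    have hmono : StrictMonoOn v (Set.Ici 0) := by
      refine strictMonoOn_of_deriv_pos (convex_Ici 0) hv fun r hr => ?_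
      rw [interior_Ici] at hr
      rw [(hvd r hr).deriv]
      exact hw.pos r hr
    have := hmono Set.self_mem_Ici (Set.mem_Ici.2 zero_le_one) zero_lt_one
    simp only [hu, norm_zero, PiLp.norm_single, norm_one]
    exact this.ne
  · intro x hx
    set r := ‖x‖ with hr
    have hr0 : 0 < r := norm_pos_iff.2 hx
    have hwr := hw.pos r hr0
    have hgn : ‖∇ u x‖ = w r := by
      rw [(hF x).gradient, norm_smul, ← hr, Real.norm_of_nonneg (by positivity), Real.rpow_neg_one,
        mul_assoc, inv_mul_cancel₀ hr0.ne', mul_one]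
    have hfv := hf_pos (v r)
    have hw'r : 0 < w' r := by
      have h1 : 0 < (p - 1) * (w r ^ ((k : ℝ) * (p - β - 1) + 1 - 2) * w' r) :=
        lt_of_lt_of_le (by positivity) (hineq r hr0)
      have h2 : 0 < w r ^ ((k : ℝ) * (p - β - 1) + 1 - 2) * w' r :=
        (mul_pos_iff_of_pos_left (by linarith)).1 h1
      exact (mul_pos_iff_of_pos_left (by positivity)).1 h2
    refine ⟨?_, ?_, ?_⟩
    · rw [hpG]
      exact (hasFDerivAt_radialField hφ.hasDerivAt hx).differentiableAt
    · intro _ h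
      rw [h, norm_zero] at hgn
      exact hwr.ne hgn
    · have hH := pHessian_of_radialField hφ.hasDerivAt hpG hx
      set a := w r ^ (p - 1) * r ^ (-1 : ℝ) with ha
      have ha0 : 0 < a := by positivity
      set b := w' r * (p - 1) * w r ^ (p - 1 - 1) with hb
      have hp1 : 0 < p - 1 := by linarith
      have hb0 : 0 < b := by positivity
      have hev := isEigenvalueVector_smul_one_add_vecMulVec a
        ((b * r ^ (-1 : ℝ) + w r ^ (p - 1) * (-1 * r ^ ((-1 : ℝ) - 1))) * r⁻¹) x i₀
      rw [← hH] at hev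
      have hxx : (x : Fin n → ℝ) ⬝ᵥ x = r ^ 2 := by
        rw [hr, EuclideanSpace.real_norm_sq_eq]
        simp [dotProduct, sq]
      have hb' : a + (b * r ^ (-1 : ℝ) + w r ^ (p - 1) * (-1 * r ^ ((-1 : ℝ) - 1))) * r⁻¹ *
          ((x : Fin n → ℝ) ⬝ᵥ x) = b := by
        rw [hxx, ha, Real.rpow_sub hr0, Real.rpow_neg_one, Real.rpow_one]
        field_simp
        ring
      rw [hb'] at hev
      refine ⟨_, hev, fun i _ hik => symPoly_pos (hik.trans hkn) fun j => ?_, ?_⟩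
      · rcases eq_or_ne j i₀ with rfl | h
        · rwa [Function.update_self]
        · rwa [Function.update_of_ne h]
      · have h1 := mul_pow_le_symPoly_update hk hkn ha0 hb0 i₀
        rw [hgn]
        set X := r ^ α * w r ^ β * f (v r) with hX
        have hX0 : 0 < X := by positivity
        have h2 : X ^ k ≤ b * a ^ (k - 1) := by
          obtain ⟨j, rfl⟩ : ∃ j, k = j + 1 := ⟨k - 1, by omega⟩
          have h3 := hineq r hr0
          push_cast at h3
          have e1 : X ^ (j + 1) = w r ^ (β * (j + 1)) * r ^ (-(j : ℝ)) *
              (r ^ (((j : ℝ) + 1) * α + (j + 1) - 1) * f (v r) ^ (j + 1)) := by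
            have e2 : r ^ (-(j : ℝ)) * r ^ (((j : ℝ) + 1) * α + (j + 1) - 1) =
                r ^ (α * ((j + 1 : ℕ) : ℝ)) := by
              rw [← Real.rpow_add hr0]
              congr 1; push_cast; ring
            have e3 : w r ^ (β * (j + 1)) = w r ^ (β * ((j + 1 : ℕ) : ℝ)) := by push_cast; rfl
            calc X ^ (j + 1) = (r ^ α) ^ (j + 1) * (w r ^ β) ^ (j + 1) * f (v r) ^ (j + 1) := by
                  rw [hX, mul_pow, mul_pow]
              _ = r ^ (α * ((j + 1 : ℕ) : ℝ)) * w r ^ (β * ((j + 1 : ℕ) : ℝ)) *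
                  f (v r) ^ (j + 1) := by
                  rw [Real.rpow_mul_natCast hr0.le, Real.rpow_mul_natCast hwr.le]
              _ = _ := by rw [← e2, ← e3]; ring
          have e4 : b * a ^ (j + 1 - 1) = w r ^ (β * (j + 1)) * r ^ (-(j : ℝ)) *
              ((p - 1) * (w r ^ (((j : ℝ) + 1) * (p - β - 1) + 1 - 2) * w' r)) := by
            have e5 : w r ^ (β * ((j : ℝ) + 1)) * w r ^ (((j : ℝ) + 1) * (p - β - 1) + 1 - 2) =
                w r ^ (p - 1 - 1) * (w r ^ (p - 1)) ^ j := by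
              rw [← Real.rpow_mul_natCast hwr.le, ← Real.rpow_add hwr, ← Real.rpow_add hwr]
              congr 1; ring
            have e6 : (r ^ (-1 : ℝ)) ^ j = r ^ (-(j : ℝ)) := by
              rw [← Real.rpow_mul_natCast hr0.le]
              congr 1; ring
            calc b * a ^ (j + 1 - 1) =
                  w' r * (p - 1) * (w r ^ (p - 1 - 1) * (w r ^ (p - 1)) ^ j) *
                    (r ^ (-1 : ℝ)) ^ j := by
                  rw [Nat.add_sub_cancel, ha, hb, mul_pow]; ring
              _ = _ := by rw [← e5, e6]; ring
          rw [e1, e4]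
          gcongr
        have hk0 : k ≠ 0 := by omega
        calc X = (X ^ k) ^ ((k : ℝ)⁻¹) := (Real.pow_rpow_inv_natCast hX0.le hk0).symm
          _ ≤ _ := by
            rw [one_div]
            exact Real.rpow_le_rpow (by positivity) (h2.trans h1) (by positivity)

end

/-! ### Weak derivatives across an isolated singularity and Sobolev regularity. -/

section

variable {n : ℕ}

theorem ae_ne_zero_euclideanSpace (j : Fin n) :
    ∀ᵐ x : EuclideanSpace ℝ (Fin n), x ≠ 0 := by
  have : Nonempty (Fin n) := ⟨j⟩
  exact Measure.ae_ne volume 0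

/-- The integral of a partial derivative of a compactly supported continuous function that is
differentiable off the origin vanishes. -/
theorem integral_partial_eq_zero {ψ : EuclideanSpace ℝ (Fin n) → ℝ}
    {ψ' : EuclideanSpace ℝ (Fin n) → EuclideanSpace ℝ (Fin n) →L[ℝ] ℝ} (hψ : Continuous ψ)
    (hsupp : HasCompactSupport ψ) (hd : ∀ x, x ≠ 0 → HasFDerivAt ψ (ψ' x) x) (j : Fin n)
    (hint : Integrable fun x => ψ' x (EuclideanSpace.single j 1)) :
    ∫ x, ψ' x (EuclideanSpace.single j 1) = 0 := by
  obtain ⟨m, rfl⟩ : ∃ m, n = m + 1 := ⟨n - 1, by have := j.pos; omega⟩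
  obtain ⟨R, hR0, hR⟩ : ∃ R : ℝ, 0 < R ∧ ∀ x, R ≤ ‖x‖ → ψ x = 0 :=
    hsupp.exists_pos_le_norm
  set S := R + 1 with hS
  let L : (Fin (m + 1) → ℝ) ≃L[ℝ] EuclideanSpace ℝ (Fin (m + 1)) :=
    (PiLp.continuousLinearEquiv 2 ℝ fun _ : Fin (m + 1) => ℝ).symm
  have hLs : ∀ i : Fin (m + 1), L (Pi.single i 1) = EuclideanSpace.single i 1 := fun i => rfl
  have hLmp : MeasurePreserving L volume volume := PiLp.volume_preserving_toLp (Fin (m + 1))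
  have hLe : MeasurableEmbedding L := L.toHomeomorph.measurableEmbedding
  have hcoord : ∀ (x : Fin (m + 1) → ℝ) i, |x i| ≤ ‖L x‖ := fun x i =>
    PiLp.norm_apply_le (L x) i
  have hzero : ∀ x : Fin (m + 1) → ℝ, (∃ i, S ≤ |x i|) → ψ (L x) = 0 := by
    rintro x ⟨i, hi⟩
    exact hR _ (by have := hcoord x i; linarith)
  have hzero' : ∀ x : EuclideanSpace ℝ (Fin (m + 1)), R < ‖x‖ → ψ' x = 0 := by
    intro x hx
    have hx0 : x ≠ 0 := by
      rintro rfl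
      rw [norm_zero] at hx
      linarith
    have h1 : ψ =ᶠ[𝓝 x] fun _ => 0 := by
      filter_upwards [continuous_norm.continuousAt.eventually (lt_mem_nhds hx)] with y hy
      exact hR y hy.le
    exact (hd x hx0).unique ((hasFDerivAt_const 0 x).congr_of_eventuallyEq h1)
  have hint' : Integrable fun x => ψ' (L x) (EuclideanSpace.single j 1) :=
    (hLmp.integrable_comp_emb hLe).2 hint
  -- The divergence theorem on a cube, for the field whose only component is `ψ` in direction `j`.
  -- It tolerates a countable exceptional set, here the origin, as long as the field is continuous.
  -- The cube is large enough for `ψ` to vanish on its faces.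
  have hdiv := integral_divergence_of_hasFDerivAt_off_countable'
    (fun _ : Fin (m + 1) => -S) (fun _ => S) (fun _ => by linarith)
    (fun i x => if i = j then ψ (L x) else 0)
    (fun i x => if i = j then (ψ' (L x)).comp (L : (Fin (m + 1) → ℝ) →L[ℝ] _) else 0)
    {0} (Set.countable_singleton 0) ?_ ?_ ?_
  · have hsum : ∀ x : Fin (m + 1) → ℝ, ∑ i : Fin (m + 1),
        (if i = j then (ψ' (L x)).comp (L : (Fin (m + 1) → ℝ) →L[ℝ] _) else 0) (Pi.single i 1) =
        ψ' (L x) (EuclideanSpace.single j 1) := by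
      intro x
      rw [Finset.sum_eq_single j]
      · rw [if_pos rfl, ← hLs]; rfl
      · intro i _ hi
        rw [if_neg hi]; rfl
      · simp
    simp only [hsum] at hdiv
    rw [← hLmp.integral_comp hLe, ← setIntegral_eq_integral_of_forall_compl_eq_zero
      (s := Set.Icc (fun _ : Fin (m + 1) => -S) (fun _ => S)), hdiv]
    · refine Finset.sum_eq_zero fun i _ => ?_
      rcases eq_or_ne i j with rfl | hi
      · simp only [if_true]
        have e1 : ∀ (t : ℝ) (y : Fin m → ℝ), S ≤ |t| → ψ (L (i.insertNth t y)) = 0 := by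
          intro t y ht
          exact hzero _ ⟨i, by simpa using ht⟩
        have hSabs : |S| = S := abs_of_pos (by linarith)
        simp [e1 S _ hSabs.ge, e1 (-S) _ (by rw [abs_neg]; exact hSabs.ge)]
      · simp [hi]
    · intro x hx
      have : ∃ i, S < |x i| := by
        by_contra! hcon
        exact hx ⟨fun i => (abs_le.1 (hcon i)).1, fun i => (abs_le.1 (hcon i)).2⟩
      obtain ⟨i, hi⟩ := this
      rw [hzero' (L x) (by have := hcoord x i; linarith)]
      rfl
  · intro i
    rcases eq_or_ne i j with rfl | hi
    · simpa [Function.comp_def] using (hψ.comp L.continuous).continuousOn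
    · simpa [hi] using continuousOn_const
  · intro x hx i
    rcases eq_or_ne i j with rfl | hi
    · simp only [if_true]
      have hx0 : L x ≠ 0 := by
        rw [Ne, L.map_eq_zero_iff]
        exact hx.2
      exact (hd (L x) hx0).comp x L.hasFDerivAt
    · simp only [hi, if_false]
      exact hasFDerivAt_const 0 x
  · have hsum : (fun x : Fin (m + 1) → ℝ => ∑ i : Fin (m + 1),
        (if i = j then (ψ' (L x)).comp (L : (Fin (m + 1) → ℝ) →L[ℝ] _) else 0) (Pi.single i 1)) =
        fun x => ψ' (L x) (EuclideanSpace.single j 1) := by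
      funext x
      rw [Finset.sum_eq_single j]
      · rw [if_pos rfl, ← hLs]; rfl
      · intro i _ hi
        rw [if_neg hi]; rfl
      · simp
    rw [hsum]
    exact hint'.integrableOn

/-- An isolated singularity of the derivative does not affect the weak derivative of a continuous
function. -/
theorem isWeakPartial_of_hasFDerivAt {w : EuclideanSpace ℝ (Fin n) → ℝ}
    {w' : EuclideanSpace ℝ (Fin n) → EuclideanSpace ℝ (Fin n) →L[ℝ] ℝ} (hw : Continuous w)
    (hd : ∀ x, x ≠ 0 → HasFDerivAt w (w' x) x) (j : Fin n)
    (hint : LocallyIntegrable fun x => w' x (EuclideanSpace.single j 1)) :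
    IsWeakPartial j w fun x => w' x (EuclideanSpace.single j 1) := by
  intro φ hφ hφs
  have hφd : Differentiable ℝ φ := hφ.differentiable (by norm_num)
  have h1 : Integrable fun x => w x * fderiv ℝ φ x (EuclideanSpace.single j 1) := by
    refine Continuous.integrable_of_hasCompactSupport ?_ ?_
    · exact hw.mul ((hφ.continuous_fderiv (by norm_num)).clm_apply continuous_const)
    · exact (hφs.fderiv_apply ℝ _).mul_left
  have h2 : Integrable fun x => w' x (EuclideanSpace.single j 1) * φ x := by
    have := hint.integrable_smul_right_of_hasCompactSupport hφ.continuous hφs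
    simpa [smul_eq_mul, mul_comm] using this
  have h3 := integral_partial_eq_zero (ψ := fun x => w x * φ x)
    (ψ' := fun x => w x • fderiv ℝ φ x + φ x • w' x) (hw.mul hφ.continuous) hφs.mul_left
    (fun x hx => (hd x hx).mul (hφd x).hasFDerivAt) j ?_
  · have h4 : ∀ x, (w x • fderiv ℝ φ x + φ x • w' x) (EuclideanSpace.single j 1) =
        w x * fderiv ℝ φ x (EuclideanSpace.single j 1) +
          w' x (EuclideanSpace.single j 1) * φ x := by
      intro x
      simp only [_root_.add_apply, _root_.smul_apply, smul_eq_mul]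
      ring
    simp only [h4] at h3
    rw [integral_add h1 h2] at h3
    linarith
  · refine (h1.add h2).congr (Eventually.of_forall fun x => ?_)
    simp only [Pi.add_apply, _root_.add_apply, _root_.smul_apply, smul_eq_mul]
    ring

theorem memLpLoc_of_continuous {δ : ℝ} {g : EuclideanSpace ℝ (Fin n) → ℝ} (hg : Continuous g) :
    MemLpLoc δ g := by
  intro K hK
  obtain ⟨C, hC⟩ := hK.exists_bound_of_continuousOn hg.continuousOn
  have : IsFiniteMeasure (volume.restrict K) := ⟨by
    rw [Measure.restrict_apply_univ]; exact hK.measure_lt_top⟩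
  refine MemLp.of_bound hg.aestronglyMeasurable C ?_
  filter_upwards [ae_restrict_mem hK.measurableSet] with x hx using hC x hx

/-- In polar coordinates the integrand becomes `r^{n-1+sδ}`. The weight `r^{n-1}` only helps, so `sδ
> -1` suffices in every dimension. -/
theorem memLp_norm_rpow_ball {δ s R : ℝ} (hδ : 1 ≤ δ) (hs : -1 < s * δ) (j : Fin n) :
    MemLp (fun x : EuclideanSpace ℝ (Fin n) => ‖x‖ ^ s) (ENNReal.ofReal δ)
      (volume.restrict (Metric.ball 0 R)) := by
  have : Nonempty (Fin n) := ⟨j⟩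
  have hδ0 : 0 < δ := by linarith
  have hm : Measurable (fun x : EuclideanSpace ℝ (Fin n) => ‖x‖ ^ s) :=
    measurable_norm.pow_const s
  rw [← integrable_norm_rpow_iff hm.aestronglyMeasurable (by simpa using hδ0)
    ENNReal.ofReal_ne_top, ENNReal.toReal_ofReal hδ0.le]
  have h1 : (fun x : EuclideanSpace ℝ (Fin n) => ‖‖x‖ ^ s‖ ^ δ) = fun x => ‖x‖ ^ (s * δ) := by
    funext x
    rw [Real.norm_of_nonneg (by positivity), Real.rpow_mul (norm_nonneg x)]
  rw [h1]
  refine (integrableOn_fun_norm_addHaar volume (f := fun r : ℝ => r ^ (s * δ))).2 ?_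
  rcases le_or_gt R 0 with hR | hR
  · rw [Set.Ioo_eq_empty (not_lt.2 hR)]
    exact integrableOn_empty
  have h2 : IntegrableOn (fun r : ℝ => r ^ (((Module.finrank ℝ (EuclideanSpace ℝ (Fin n)) - 1 :
      ℕ) : ℝ) + s * δ)) (Set.Ioo 0 R) := by
    rw [intervalIntegral.integrableOn_Ioo_rpow_iff hR]
    have : (0 : ℝ) ≤ ((Module.finrank ℝ (EuclideanSpace ℝ (Fin n)) - 1 : ℕ) : ℝ) := by positivity
    linarith
  refine h2.congr_fun (fun r hr => ?_) measurableSet_Ioo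
  simp only [smul_eq_mul]
  rw [Real.rpow_add hr.1, Real.rpow_natCast]

/-- The quotient of the two sides is continuous on `(0, R]` and has a finite limit at the origin,
hence is bounded. -/
theorem IsPowerLike.exists_bound {a : ℝ} {φ φ' : ℝ → ℝ} (h : IsPowerLike a φ φ') (R : ℝ) :
    ∃ C, ∀ r, 0 < r → r ≤ R → |φ r| + |r * φ' r| ≤ C * r ^ a := by
  obtain ⟨L, hL, hLt⟩ := h.tendsto
  set q : ℝ → ℝ := fun r => |φ r / r ^ a| * (1 + |r * φ' r / φ r|) with hq
  have hqe : ∀ r, 0 < r → |φ r| + |r * φ' r| = q r * r ^ a := by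
    intro r hr
    have h1 := h.pos r hr
    have h2 := Real.rpow_pos_of_pos hr a
    simp only [hq, abs_div, abs_of_pos h1, abs_of_pos h2]
    field_simp
  have hqt : Tendsto q (𝓝[>] 0) (𝓝 (|L| * (1 + |a|))) :=
    hLt.abs.mul (tendsto_const_nhds.add h.tendsto_log.abs)
  have hqc : ContinuousOn q (Set.Ioi 0) := by
    refine (ContinuousOn.abs ?_).mul (continuousOn_const.add (ContinuousOn.abs ?_))
    · exact h.continuousOn_self.div (continuousOn_id.rpow_const fun r hr => Or.inl (ne_of_gt hr))
        fun r hr => (Real.rpow_pos_of_pos hr a).ne'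
    · exact (continuousOn_id.mul h.continuousOn).div h.continuousOn_self
        fun r hr => (h.pos r hr).ne'
  have hev := hqt.eventually (gt_mem_nhds (lt_add_one (|L| * (1 + |a|))))
  obtain ⟨ε, hε, hεq⟩ := mem_nhdsGT_iff_exists_Ioo_subset.1 hev
  have hε0 : (0 : ℝ) < ε := hε
  obtain ⟨M, hM⟩ := (isCompact_Icc (a := ε / 2) (b := R)).exists_bound_of_continuousOn
    (hqc.mono fun r hr => lt_of_lt_of_le (by positivity) hr.1)
  refine ⟨max (|L| * (1 + |a|) + 1) M, fun r hr hrR => ?_⟩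
  rw [hqe r hr]
  refine mul_le_mul_of_nonneg_right ?_ (Real.rpow_nonneg hr.le a)
  rcases lt_or_ge r (ε / 2) with h1 | h1
  · exact (le_of_lt (hεq ⟨hr, by linarith⟩)).trans (le_max_left _ _)
  · exact ((le_abs_self _).trans (hM r ⟨h1, hrR⟩)).trans (le_max_right _ _)

theorem memLpLoc_radialFieldDeriv {δ a : ℝ} {φ φ' : ℝ → ℝ} (h : IsPowerLike a φ φ') (hδ : 1 ≤ δ)
    (ha : -1 < a * δ) (i j : Fin n) :
    MemLpLoc δ fun x => radialFieldDeriv (n := n) φ φ' x (EuclideanSpace.single j 1) i := by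
  intro K hK
  obtain ⟨R, hR0, hR⟩ := hK.isBounded.exists_pos_norm_le
  have hKR : K ⊆ Metric.ball 0 (R + 1) := fun x hx => by
    rw [mem_ball_zero_iff]
    linarith [hR x hx]
  obtain ⟨C, hC⟩ := h.exists_bound (R + 1)
  have hmem := ((memLp_norm_rpow_ball (n := n) (R := R + 1) hδ ha j).mono_measure
    (Measure.restrict_mono hKR le_rfl)).const_mul C
  have : Nonempty (Fin n) := ⟨j⟩
  have hmeas : AEStronglyMeasurable
      (fun x => radialFieldDeriv (n := n) φ φ' x (EuclideanSpace.single j 1) i) volume := by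
    have h1 : ContinuousOn
        (fun x => radialFieldDeriv (n := n) φ φ' x (EuclideanSpace.single j 1) i) {0}ᶜ := by
      have h2 := (continuousOn_radialFieldDeriv (n := n) h.hasDerivAt h.continuousOn).clm_apply
        (continuousOn_const (c := EuclideanSpace.single j (1 : ℝ)))
      exact (EuclideanSpace.proj (𝕜 := ℝ) i).continuous.comp_continuousOn h2
    have h3 := h1.aestronglyMeasurable (μ := volume) (measurableSet_singleton _).compl
    rwa [restrict_compl_singleton] at h3
  refine hmem.mono' hmeas.restrict ?_
  filter_upwards [ae_restrict_mem hK.measurableSet,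
    ae_restrict_of_ae (ae_ne_zero_euclideanSpace j)] with x hxK hx0
  have h1 := norm_radialFieldDeriv_sub_le (φ := φ) (φ' := φ') 0 (x := x)
  have e0 : radialFieldDeriv φ φ' x - (0 : ℝ) • ContinuousLinearMap.id ℝ (EuclideanSpace ℝ (Fin n)) =
      radialFieldDeriv φ φ' x := by
    ext1 y
    rw [_root_.sub_apply, _root_.smul_apply, zero_smul, sub_zero]
  rw [e0, sub_zero] at h1
  have h2 := hC ‖x‖ (norm_pos_iff.2 hx0) (by linarith [hR x hxK])
  calc ‖radialFieldDeriv φ φ' x (EuclideanSpace.single j 1) i‖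
      ≤ ‖radialFieldDeriv φ φ' x (EuclideanSpace.single j 1)‖ := PiLp.norm_apply_le _ i
    _ ≤ ‖radialFieldDeriv φ φ' x‖ * ‖EuclideanSpace.single j (1 : ℝ)‖ :=
        ContinuousLinearMap.le_opNorm _ _
    _ = ‖radialFieldDeriv φ φ' x‖ := by simp
    _ ≤ _ := h1.trans h2

/-- A `C¹` function whose gradient is a radial field with a power singularity is in `W^{2,δ}_loc`. -/
theorem memSobolevTwoLoc_of_radialField {δ a : ℝ} {φ φ' : ℝ → ℝ} (h : IsPowerLike a φ φ')
    (hδ : 1 ≤ δ) (ha : -1 < a * δ) {u : EuclideanSpace ℝ (Fin n) → ℝ}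
    (hF : ∀ x, HasGradientAt u (φ ‖x‖ • x) x)
    (hc : Continuous fun x : EuclideanSpace ℝ (Fin n) => φ ‖x‖ • x) :
    MemSobolevTwoLoc δ u := by
  have hu : Continuous u := continuous_iff_continuousAt.2 fun x => (hF x).continuousAt
  have hcoord : ∀ i : Fin n, Continuous fun x : EuclideanSpace ℝ (Fin n) => (φ ‖x‖ • x) i :=
    fun i => (EuclideanSpace.proj (𝕜 := ℝ) i).continuous.comp hc
  refine ⟨memLpLoc_of_continuous hu, fun i x => (φ ‖x‖ • x) i,
    fun i j x => radialFieldDeriv φ φ' x (EuclideanSpace.single j 1) i,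
    fun i => ⟨memLpLoc_of_continuous (hcoord i), ?_⟩,
    fun i j => ⟨memLpLoc_radialFieldDeriv h hδ ha i j, ?_⟩⟩
  · have e : ∀ x : EuclideanSpace ℝ (Fin n), (φ ‖x‖ • x) i =
        innerSL ℝ (φ ‖x‖ • x) (EuclideanSpace.single i 1) := by
      intro x
      rw [innerSL_apply_apply, EuclideanSpace.inner_single_right]
      simp
    simp only [e]
    refine isWeakPartial_of_hasFDerivAt (w' := fun x => innerSL ℝ (φ ‖x‖ • x)) hu
      (fun x _ => hasGradientAt_iff_hasFDerivAt.1 (hF x)) i ?_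
    simp only [← e]
    exact (hcoord i).locallyIntegrable
  · refine isWeakPartial_of_hasFDerivAt
      (w' := fun x => (EuclideanSpace.proj (𝕜 := ℝ) i).comp (radialFieldDeriv φ φ' x)) (hcoord i)
      (fun x hx => ?_) j ?_
    · exact (EuclideanSpace.proj (𝕜 := ℝ) i).hasFDerivAt.comp x
        (hasFDerivAt_radialField h.hasDerivAt hx)
    · rw [locallyIntegrable_iff]
      intro K hK
      have : IsFiniteMeasure (volume.restrict K) := ⟨by
        rw [Measure.restrict_apply_univ]; exact hK.measure_lt_top⟩
      refine (memLpLoc_radialFieldDeriv h hδ ha i j K hK).integrable ?_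
      rw [← ENNReal.ofReal_one]
      exact ENNReal.ofReal_le_ofReal hδ

end

/-! ### Sufficiency and the final equivalences. -/

/-- Existence and regularity of a radial subsolution under the Keller–Osserman condition. -/
theorem exists_subsolution_of_kellerOsserman {n k : ℕ} (hk : 1 ≤ k) (hkn : k ≤ n)
    {p α β : ℝ} {f : ℝ → ℝ} (hf_cont : Continuous f) (hf_mono : Monotone f) (hf_pos : ∀ t, 0 < f t)
    (hα : 1 / (k : ℝ) - 1 ≤ α) (hβ : β < p - 1) (hp : 1 < p) (hKO : KellerOsserman k p β f) :
    ∃ u : EuclideanSpace ℝ (Fin n) → ℝ, IsEntireAdmissibleSubsolution k p α β f u ∧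
      (p ≤ α + β + 2 → ContDiff ℝ 2 u) ∧
      (0 ≤ (p - 1) * α + β → ContDiff ℝ 1 (pGradient p u)) ∧
      (α + β + 2 < p → ∀ δ : ℝ, 1 < δ → δ < (p - β - 1) / (p - α - β - 2) →
        MemSobolevTwoLoc δ u) := by
  have hk0 : (0 : ℝ) < k := by exact_mod_cast hk
  have hq : 0 < p - β - 1 := by linarith
  set N : ℝ := (k : ℝ) * (p - β - 1) + 1 with hN
  have hN1 : 1 < N := by
    have := mul_pos hk0 hq
    linarith
  have hσ : 0 ≤ (k : ℝ) * α + k - 1 := by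
    have := mul_le_mul_of_nonneg_left hα hk0.le
    rw [mul_sub, mul_one_div_cancel hk0.ne'] at this
    linarith
  have hα1 : 0 < α + 1 := by
    have : 0 < 1 / (k : ℝ) := by positivity
    linarith
  obtain ⟨v, w, w', hv, hvd, hw, hineq⟩ := exists_radial_profile (g := fun s => f s ^ k)
    (hf_cont.pow k) (fun s t hst => pow_le_pow_left₀ (hf_pos s).le (hf_mono hst) k)
    (fun t => pow_pos (hf_pos t) k) hN1 hσ (show 0 < p - 1 by linarith) (hKO 1 one_pos)
  have hexp : ((k : ℝ) * α + k - 1 + 1) / (N - 1) = (α + 1) / (p - β - 1) := by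
    rw [hN, add_sub_cancel_right, sub_add_cancel, ← mul_add_one, mul_div_mul_left _ _ hk0.ne']
  rw [hexp] at hw
  -- Near the origin `|Du|` is of order `r^e`, while `D²u` and `D(|Du|^{p-2}Du)` are of order at
  -- most `r^{e-1}` and `r^{e(p-1)-1}`. The three regularity claims rest on `e ≥ 1`, which is `p ≤
  -- α+β+2`; on `e(p-1) ≥ 1`, which is `(p-1)α+β ≥ 0`; and on `(e-1)δ > -1`, which is the upper
  -- bound on `δ`.
  set e : ℝ := (α + 1) / (p - β - 1) with he
  have he0 : 0 < e := div_pos hα1 hq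
  obtain ⟨c, hwc, -, hc0⟩ := hw.exists_tendsto he0.le
  rw [hc0 he0] at hwc
  have hF := hasGradientAt_radial (n := n) hv hvd hwc
  have hφ₁ := hw.mul (IsPowerLike.rpow_id (-1))
  have hφ := (hw.rpow (p - 1)).mul (IsPowerLike.rpow_id (-1))
  have hpG := pGradient_eq_radialField (p := p) hw.pos hF
  refine ⟨fun x => v ‖x‖, isEntireAdmissibleSubsolution_radial hk hkn hf_pos hp he0 hv hvd hw hineq,
    fun h => ?_, fun h => ?_, fun h δ hδ1 hδ2 => ?_⟩
  · have he1 : 0 ≤ e + -1 := by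
      have : 1 ≤ e := by
        rw [he, le_div_iff₀ hq]
        linarith
      linarith
    obtain ⟨c, hc, hc', -⟩ := hφ₁.exists_tendsto he1
    rw [← contDiffOn_univ]
    exact contDiffOn_two_of_hasGradientAt hF isOpen_univ
      (contDiff_one_radialField hφ₁.hasDerivAt hφ₁.continuousOn hc hc').contDiffOn
  · have he1 : 0 ≤ e * (p - 1) + -1 := by
      have : 1 ≤ e * (p - 1) := by
        rw [he, div_mul_eq_mul_div, le_div_iff₀ hq]
        nlinarith
      linarith
    obtain ⟨c, hc, hc', -⟩ := hφ.exists_tendsto he1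
    rw [hpG]
    exact contDiff_one_radialField hφ.hasDerivAt hφ.continuousOn hc hc'
  · refine memSobolevTwoLoc_of_radialField hφ₁ hδ1.le ?_ hF
      (continuous_radialField hφ₁.continuousOn_self ?_)
    · rw [lt_div_iff₀ (by linarith)] at hδ2
      have h1 : e + -1 = -((p - α - β - 2) / (p - β - 1)) := by
        rw [he]; field_simp; ring
      rw [h1, neg_mul, neg_lt_neg_iff, div_mul_eq_mul_div, div_lt_one hq]
      linarith
    · refine hwc.congr' ?_
      filter_upwards [self_mem_nhdsWithin] with r hr
      have : r ≠ 0 := ne_of_gt hr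
      rw [Real.rpow_neg_one]
      field_simp

theorem theorem4p1 (n k : ℕ) (hk : 1 ≤ k) (hkn : k ≤ n) (p α β : ℝ) (f : ℝ → ℝ)
    (hf_cont : Continuous f) (hf_mono : Monotone f) (hf_pos : ∀ t, 0 < f t)
    (hα : 1 / (k : ℝ) - 1 ≤ α) (hβ : β < p - 1) (hp : 1 < p) :
    (p ≤ α + β + 2 →
      ((∃ u : EuclideanSpace ℝ (Fin n) → ℝ,
          ContDiff ℝ 2 u ∧ IsEntireAdmissibleSubsolution k p α β f u) ↔
        KellerOsserman k p β f) ∧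
      (KellerOsserman k p β f →
        ∃ u : EuclideanSpace ℝ (Fin n) → ℝ,
          ContDiff ℝ 2 u ∧ IsEntireAdmissibleSubsolution k p α β f u ∧
          (0 ≤ (p - 1) * α + β → ContDiff ℝ 1 (pGradient p u)))) ∧
    (α + β + 2 < p → 0 ≤ (p - 1) * α + β →
      (∀ δ : ℝ, 1 < δ → δ < (p - β - 1) / (p - α - β - 2) →
        ((∃ u : EuclideanSpace ℝ (Fin n) → ℝ,
            MemSobolevTwoLoc δ u ∧ IsEntireAdmissibleSubsolution k p α β f u) ↔
          KellerOsserman k p β f)) ∧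
      (KellerOsserman k p β f →
        ∃ u : EuclideanSpace ℝ (Fin n) → ℝ,
          IsEntireAdmissibleSubsolution k p α β f u ∧
          ContDiff ℝ 1 (pGradient p u) ∧
          ∀ δ : ℝ, 1 < δ → δ < (p - β - 1) / (p - α - β - 2) → MemSobolevTwoLoc δ u)) := by
  have hnec : ∀ u : EuclideanSpace ℝ (Fin n) → ℝ, IsEntireAdmissibleSubsolution k p α β f u →
      KellerOsserman k p β f := fun u hu =>
    kellerOsserman_of_isEntireAdmissibleSubsolution hk hkn hf_cont hf_mono hf_pos hα hβ hp hu
  have hsuf := exists_subsolution_of_kellerOsserman (n := n) hk hkn hf_cont hf_mono hf_pos hα hβ hp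
  refine ⟨fun h => ⟨⟨fun ⟨u, _, hu⟩ => hnec u hu, fun hKO => ?_⟩, fun hKO => ?_⟩,
    fun h h' => ⟨fun δ hδ1 hδ2 => ⟨fun ⟨u, _, hu⟩ => hnec u hu, fun hKO => ?_⟩, fun hKO => ?_⟩⟩
  · obtain ⟨u, hu, hu2, -, -⟩ := hsuf hKO
    exact ⟨u, hu2 h, hu⟩
  · obtain ⟨u, hu, hu2, hpu, -⟩ := hsuf hKO
    exact ⟨u, hu2 h, hu, hpu⟩
  · obtain ⟨u, hu, -, -, hS⟩ := hsuf hKO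
    exact ⟨u, hS h δ hδ1 hδ2, hu⟩
  · obtain ⟨u, hu, -, hpu, hS⟩ := hsuf hKO
    exact ⟨u, hu, hpu h', hS h⟩
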